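/- Let the $7$-qubit Steane code be the CSS code whose $X$-type and $Z$-type stabilizer generators both have the supports given by the rows $1111000$, $1100110$, $1010101$, with logical operators $X^{\otimes 7}$, $Z^{\otimes 7}$ (so $Z_1Z_2Z_7$ is a logical $Z$). Let the $15$-qubit Reed–Muller (RM) code be the CSS code with $X$-type generators supported on $v_k=\{\,i\in\{1,\dots,15\}: \text{the } k\text{-th binary digit of } i \text{ is } 1\}$, $0\le k\le 3$, with $Z$-type generators supported on the sets $v_k$ and $v_k\cap v_l$ ($k<l$), and with logical operators $X^{\otimes 15}$, $Z^{\otimes 15}$. Encode a logical qubit in the Steane code, then encode only the Steane qubits in $B_1=\{1,2,7\}$ in the RM code and leave the qubits in $B_2=\{3,4,5,6\}$ unencoded. The result is an isometric encoding $V$ of one qubit into $3\cdot 15+4=49$ qubits. The image of $V$ is fixed by the RM generators on each of the three blocks and by the three $X$-type and three $Z$-type Steane generators, in which $X_b,Z_b$ is read as $X^{\otimes 15},Z^{\otimes 15}$ on block $b$ when $b\in B_1$. There is a single error-correction procedure $\mathcal R$, consisting of the measurement of these $48$ generators followed by a Pauli correction that depends only on the outcome, which is a quantum operation ($\sum_k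 R_k^\dagger R_k=1$) and has the following properties. (a) $\mathcal R$ corrects any single physical error: for every operator $E$ acting on one physical qubit and for each outcome with Kraus operator $R_k$, $R_kEV=c_kV$ for some scalar $c_k$. (b) Each gate of the standard universal gate set $\{H,S,T,\mathrm{CNOT}\}$, where $T=\mathrm{diag}(1,e^{i\pi/4})$ and $S=T^2$, and also the gate $CCZ$, has a fault-tolerant implementation without magic state distillation: there is a unitary circuit of physical gates $H,S,S^\dagger,T,T^\dagger,\mathrm{CNOT},CCZ$ that acts only on the physical qubits of the one, two or three code blocks involved (no ancillas, no prepared states, no measurements inside the circuit) and that maps the encoding of $\psi$ to the encoding of the gate applied to $\psi$, for every $\psi$. Moreover, if one arbitrary fault occurs at any time during the circuit, i.e. an arbitrary operator acting on one physical qubit (this includes an error on the input) or on the qubits of the physical gate just applied, then $\mathcal R$ applied to each code block yields, for every outcome, the encoding of the gate applied to $\psi$, up to a scalar that does not depend on $\psi$. (c) The circuits can be chosen of the following form. For $S$ and $\mathrm{CNOT}$ the circuit is transversal: each physical gate acts only on equally placed qubits of the code blocks. For $H$ it is transversal at the level of the Steane code: each physical gate acts within one RM block or on one unencoded qubit. For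 $T$ and $CCZ$ it is a piecewise transversal circuit on the RM blocks: the unencoded qubits are not touched, and each physical gate acts only on equally placed qubits of RM blocks. -/

import Mathlib

open scoped Matrix

noncomputable section

/-! ## Qubits, Pauli operators, local operators

A register of qubits labelled by a finite type `ι` has computational basis `ι → ZMod 2`; an operator
on it is a square complex matrix indexed by that basis. -/

/-- Operators on the register of qubits labelled by `ι`. -/
abbrev Op (ι : Type) : Type := Matrix (ι → ZMod 2) (ι → ZMod 2) ℂ

/-- The sign `(-1)^a` of a bit. -/
def bitSign (a : ZMod 2) : ℂ := (-1) ^ a.val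

/-- The operator `X^a`: Pauli `X` on the qubits `q` with `a q = 1`, so `|y⟩ ↦ |y + a⟩`. -/
def pauliX {ι : Type} [Fintype ι] [DecidableEq ι] (a : ι → ZMod 2) : Op ι :=
  Matrix.of fun x y => if x = y + a then 1 else 0

/-- The operator `Z^b`: Pauli `Z` on the qubits `q` with `b q = 1`. -/
def pauliZ {ι : Type} [Fintype ι] [DecidableEq ι] (b : ι → ZMod 2) : Op ι :=
  Matrix.diagonal fun x => bitSign (b ⬝ᵥ x)

/-- `E` acts only on the qubits in `S`: it is `A ⊗ 1` for some operator `A` on these qubits. -/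
def SupportedOn {ι : Type} (S : Set ι) (E : Op ι) : Prop :=
  ∃ A : Matrix (S → ZMod 2) (S → ZMod 2) ℂ, ∀ x y : ι → ZMod 2,
    ((∀ q, q ∉ S → x q = y q) → E x y = A (fun q => x q) (fun q => y q)) ∧
    ((¬ ∀ q, q ∉ S → x q = y q) → E x y = 0)

/-! ## Gates and circuits -/

/-- The elementary gates: `H`, `S`, `S†`, `T`, `T†`, `CNOT` (control `i`, target `j`) and `CCZ`, applied to
specified qubits of a register. -/
inductive Gate (ι : Type) : Type
  | h (q : ι)
  | s (q : ι)
  | sdg (q : ι)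
  | t (q : ι)
  | tdg (q : ι)
  | cnot (i j : ι) (hij : i ≠ j)
  | ccz (i j k : ι) (hij : i ≠ j) (hik : i ≠ k) (hjk : j ≠ k)

/-- The phase gate `diag(1, z)` on qubit `q`. -/
def phaseGate {ι : Type} [Fintype ι] [DecidableEq ι] (q : ι) (z : ℂ) : Op ι :=
  Matrix.diagonal fun x => if x q = 1 then z else 1

/-- The unitary operator of a gate. -/
def Gate.op {ι : Type} [Fintype ι] [DecidableEq ι] : Gate ι → Op ι
  | .h q => Matrix.of fun x y =>
      if ∀ p, p ≠ q → x p = y p then ((Real.sqrt 2 : ℝ) : ℂ)⁻¹ * bitSign (x q * y q) else 0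
  | .s q => phaseGate q Complex.I
  | .sdg q => phaseGate q (-Complex.I)
  | .t q => phaseGate q (Complex.exp (Complex.I * (Real.pi : ℂ) / 4))
  | .tdg q => phaseGate q (Complex.exp (-(Complex.I * (Real.pi : ℂ) / 4)))
  | .cnot i j _ => Matrix.of fun x y => if x = Function.update y j (y j + y i) then 1 else 0
  | .ccz i j k _ _ _ => Matrix.diagonal fun x => if x i = 1 ∧ x j = 1 ∧ x k = 1 then -1 else 1

/-- The set of qubits on which a gate acts. -/
def Gate.support {ι : Type} : Gate ι → Set ι
  | .h q => {q}
  | .s q => {q}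
  | .sdg q => {q}
  | .t q => {q}
  | .tdg q => {q}
  | .cnot i j _ => {i, j}
  | .ccz i j k _ _ _ => {i, j, k}

/-- The operator of a circuit; the head of the list is the gate that is applied first. -/
def circuitOp {ι : Type} [Fintype ι] [DecidableEq ι] : List (Gate ι) → Op ι
  | [] => 1
  | g :: C => circuitOp C * g.op

/-- `F` is the operator of a run of the circuit `C` with at most one fault. The fault `E` is an
arbitrary operator, inserted at any time (before the first gate, between two gates or after the last
gate), which acts on an arbitrary single qubit or on the qubits of the gate just applied (a faulty
gate). -/
def IsSingleFaultRun {ι : Type} [Fintype ι] [DecidableEq ι] (C : List (Gate ι)) (F : Op ι) : Prop :=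
  ∃ (before after : List (Gate ι)) (E : Op ι),
    C = before ++ after ∧ F = circuitOp after * E * circuitOp before ∧
    ((∃ q, SupportedOn {q} E) ∨
      ∃ (init : List (Gate ι)) (g : Gate ι), before = init ++ [g] ∧ SupportedOn g.support E)

/-! ## The Steane code, the 15-qubit Reed-Muller code and their non-uniform concatenation -/

/-- The encoder of the CSS code with independent `X`-type generators `X^(r i)` and logical
`X = X ⊗ ⋯ ⊗ X`: its columns are the codewords
`|l⟩ ↦ 2^(-m/2) ∑_u |∑ i, u i • r i + l • (1,…,1)⟩`, where `m` is the number of generators. -/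
def cssEncoder {R ι : Type} [Fintype R] [DecidableEq R] [Fintype ι] [DecidableEq ι]
    (r : R → ι → ZMod 2) : Matrix (ι → ZMod 2) (ZMod 2) ℂ :=
  Matrix.of fun x l => ((Real.sqrt 2 : ℝ) : ℂ)⁻¹ ^ Fintype.card R *
    ∑ u : R → ZMod 2, if x = (∑ i, u i • r i) + (fun _ => l) then 1 else 0

/-- The three rows `XXXXIII`, `XXIIXXI`, `XIXIXIX` of the Steane code (the same for `Z`). Qubits
`1,…,7` are numbered `0,…,6` here. -/
def steaneRow : Fin 3 → Fin 7 → ZMod 2 :=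
  ![![1, 1, 1, 1, 0, 0, 0], ![1, 1, 0, 0, 1, 1, 0], ![1, 0, 1, 0, 1, 0, 1]]

/-- Encoder of the 7-qubit Steane code. -/
def steaneEncoder : Matrix (Fin 7 → ZMod 2) (ZMod 2) ℂ := cssEncoder steaneRow

/-- The four weight-8 `X`-type rows of the 15-qubit Reed-Muller code: row `k` at qubit `i` is the
`k`-th binary digit of `i + 1 ∈ {1,…,15}`. -/
def rmRow (k : Fin 4) (i : Fin 15) : ZMod 2 :=
  if (i.val + 1).testBit k.val then 1 else 0

/-- Index set of the ten `Z`-type generators of the 15-qubit Reed-Muller code. -/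
abbrev RMZIndex : Type := {p : Fin 4 × Fin 4 // p.1 ≤ p.2}

/-- The ten `Z`-type rows of the 15-qubit Reed-Muller code: the four rows `rmRow k` of weight 8
(the case of a pair `(k, k)`) and the six products `rmRow k * rmRow l`, `k < l`, of weight 4. -/
def rmZRow (p : RMZIndex) (i : Fin 15) : ZMod 2 := rmRow p.1.1 i * rmRow p.1.2 i

/-- Encoder of the 15-qubit Reed-Muller code. -/
def rmEncoder : Matrix (Fin 15 → ZMod 2) (ZMod 2) ℂ := cssEncoder rmRow

/-- The Steane qubits `1, 2, 7`, which are encoded again. -/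
def B₁ : Finset (Fin 7) := {0, 1, 6}

/-- The physical qubits: a Reed-Muller block of 15 for every Steane qubit in `B₁`, and one bare
qubit for every other Steane qubit. -/
abbrev Qubit49 : Type := ({b : Fin 7 // b ∈ B₁} × Fin 15) ⊕ {b : Fin 7 // b ∉ B₁}

/-- The Steane qubit to which a physical qubit belongs. -/
def Qubit49.outer : Qubit49 → Fin 7
  | .inl p => p.1.1
  | .inr b => b.1

/-- Encoder of the concatenated code: encode in the Steane code, then encode each Steane qubit in
`B₁` in the Reed-Muller code and leave the others as they are. -/
def encoder49 : Matrix (Qubit49 → ZMod 2) (ZMod 2) ℂ :=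
  Matrix.of fun x l => ∑ y : Fin 7 → ZMod 2, steaneEncoder y l *
    ((∏ b : {b : Fin 7 // b ∈ B₁}, rmEncoder (fun i => x (.inl (b, i))) (y b.1)) *
      ∏ b : {b : Fin 7 // b ∉ B₁}, if x (.inr b) = y b.1 then 1 else 0)

/-- A generator of the Reed-Muller code, placed on the block `b`. -/
def innerCheck (b : {b : Fin 7 // b ∈ B₁}) (v : Fin 15 → ZMod 2) : Qubit49 → ZMod 2
  | .inl p => if p.1 = b then v p.2 else 0
  | .inr _ => 0

/-- A generator of the Steane code, where `X` and `Z` of an encoded Steane qubit are the logical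
`X ⊗ ⋯ ⊗ X` and `Z ⊗ ⋯ ⊗ Z` of its Reed-Muller block. -/
def outerCheck (r : Fin 3) : Qubit49 → ZMod 2 := fun q => steaneRow r q.outer

/-- Index set of the `X`-type stabilizer generators of the concatenated code. -/
abbrev XIndex : Type := ({b : Fin 7 // b ∈ B₁} × Fin 4) ⊕ Fin 3

/-- Index set of the `Z`-type stabilizer generators of the concatenated code. -/
abbrev ZIndex : Type := ({b : Fin 7 // b ∈ B₁} × RMZIndex) ⊕ Fin 3

/-- The `X`-type stabilizer generators. -/
def xCheck : XIndex → Qubit49 → ZMod 2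
  | .inl p => innerCheck p.1 (rmRow p.2)
  | .inr r => outerCheck r

/-- The `Z`-type stabilizer generators. -/
def zCheck : ZIndex → Qubit49 → ZMod 2
  | .inl p => innerCheck p.1 (rmZRow p.2)
  | .inr r => outerCheck r

/-! ## Error correction: syndrome measurement and Pauli correction -/

/-- Outcomes of the measurement of the `X`-type generators; `0` is the eigenvalue `+1`. -/
abbrev XSyndrome : Type := XIndex → ZMod 2

/-- Outcomes of the measurement of the `Z`-type generators; `0` is the eigenvalue `+1`. -/
abbrev ZSyndrome : Type := ZIndex → ZMod 2

/-- The projection onto the joint eigenspace `X^(xCheck i) = (-1)^(s i)` for all `i`, that is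
`∏ i, (1 + (-1)^(s i) X^(xCheck i)) / 2`, multiplied out. -/
def xProj (s : XSyndrome) : Op Qubit49 :=
  ((2 : ℂ) ^ Fintype.card XIndex)⁻¹ •
    ∑ u : XIndex → ZMod 2, bitSign (s ⬝ᵥ u) • pauliX (∑ i, u i • xCheck i)

/-- The projection onto the joint eigenspace `Z^(zCheck j) = (-1)^(t j)` for all `j`, that is
`∏ j, (1 + (-1)^(t j) Z^(zCheck j)) / 2`, multiplied out. -/
def zProj (t : ZSyndrome) : Op Qubit49 :=
  ((2 : ℂ) ^ Fintype.card ZIndex)⁻¹ •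
    ∑ u : ZIndex → ZMod 2, bitSign (t ⬝ᵥ u) • pauliZ (∑ j, u j • zCheck j)

/-- A decoding table: for each syndrome `(s, t)` a pair `(a, b)`, the correction being `X^a Z^b`. -/
abbrev Decoder : Type :=
  XSyndrome → ZSyndrome → (Qubit49 → ZMod 2) × (Qubit49 → ZMod 2)

/-- The Kraus operator of error correction with syndrome `(s, t)`: project onto the eigenspace of
the syndrome, then apply the Pauli correction. -/
def recovery (D : Decoder) (s : XSyndrome) (t : ZSyndrome) : Op Qubit49 :=
  pauliX (D s t).1 * pauliZ (D s t).2 * xProj s * zProj t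

/-- `D` corrects every operator on a single physical qubit: whatever the syndrome is, the state
after the correction is the original encoded state, up to a scalar. -/
def CorrectsSingleErrors (D : Decoder) : Prop :=
  ∀ (q : Qubit49) (E : Op Qubit49), SupportedOn {q} E →
    ∀ s t, ∃ c : ℂ, recovery D s t * E * encoder49 = c • encoder49

/-! ## Several code blocks and fault-tolerant gates

A register of logical qubits labelled by `κ` is encoded block by block; the physical qubits are then
labelled by `κ × Qubit49`. -/

/-- The encoder of the logical register `κ`, the tensor power of `encoder49`. -/
def blockEncoder (κ : Type) [Fintype κ] : Matrix (κ × Qubit49 → ZMod 2) (κ → ZMod 2) ℂ :=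
  Matrix.of fun x l => ∏ a, encoder49 (fun q => x (a, q)) (l a)

/-- Error correction on every block, with syndrome `(s a, t a)` in block `a`. -/
def blockRecovery {κ : Type} [Fintype κ] (D : Decoder) (s : κ → XSyndrome) (t : κ → ZSyndrome) :
    Op (κ × Qubit49) :=
  Matrix.of fun x y => ∏ a, recovery D (s a) (t a) (fun q => x (a, q)) (fun q => y (a, q))

/-- The circuit `C` on the code blocks implements the logical operator `G` fault-tolerantly: without
faults it maps the encoding of `ψ` to the encoding of `G ψ`, and after any run with a single fault,
error correction on every block leaves, for every syndrome, the encoding of `G ψ` up to a scalar. -/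
def FaultTolerant {κ : Type} [Fintype κ] [DecidableEq κ] (D : Decoder) (G : Op κ)
    (C : List (Gate (κ × Qubit49))) : Prop :=
  circuitOp C * blockEncoder κ = blockEncoder κ * G ∧
    ∀ F : Op (κ × Qubit49), IsSingleFaultRun C F → ∀ s t, ∃ c : ℂ,
      blockRecovery D s t * F * blockEncoder κ = c • (blockEncoder κ * G)

/-- Transversal circuit: every gate acts on equally placed qubits of the code blocks only. -/
def IsTransversal {κ : Type} (C : List (Gate (κ × Qubit49))) : Prop :=
  ∀ g ∈ C, ∃ q : Qubit49, ∀ p ∈ g.support, p.2 = q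

/-- Circuit that is transversal at the level of the Steane code: every gate acts on the physical
qubits of equally placed Steane qubits only. -/
def IsSteaneTransversal {κ : Type} (C : List (Gate (κ × Qubit49))) : Prop :=
  ∀ g ∈ C, ∃ b : Fin 7, ∀ p ∈ g.support, p.2.outer = b

/-- Circuit all of whose steps are transversal at the level of the Reed-Muller code: the bare qubits
are not touched, and every gate acts on equally placed qubits of the Reed-Muller blocks only. -/
def IsRMTransversal {κ : Type} (C : List (Gate (κ × Qubit49))) : Prop :=
  ∀ g ∈ C, ∃ i : Fin 15, ∀ p ∈ g.support, ∃ b : {b : Fin 7 // b ∈ B₁}, p.2 = .inl (b, i)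

end

/-!
Everything rests on the Pauli operators `X^a Z^b`, which span all operators on a given set of qubits
(`SupportedOn.mem_pauliSpan`), so that only Pauli faults have to be corrected.

*The code.* Collapsing the two encoding steps, the concatenation is itself the CSS code of the
generators `xCheck` (`encoder49_eq_cssEncoder`), which gives the isometry, the stabilizers and the
basis states that occur in codewords.

*The decoder.* Call a set of physical qubits correctable if it lies over one Steane qubit, or
consists of qubits at one position of the Reed-Muller blocks. Bit flips and phase flips are decoded
separately, each to any pattern with correctable support and the measured syndrome. This works
because two such patterns with the same syndrome differ by a stabilizer. First, the difference is
even on every block (`blockParity_eq_zero_of_syndrome`): parts of column errors in different blocks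
are detected by the Reed-Muller code, and a difference over at most two Steane qubits by the Steane
code; both have distance three. Second, an even vector on a block with zero syndrome is a
combination of generators, by Möbius inversion of polynomials on `(ℤ/2)^4` (`exists_rmZRow_span`,
`exists_rmRow_span`).

*Fault tolerance.* If every gate of a circuit acts within a fibre of a labelling of the qubits, a
single fault is equivalent to an error within one fibre after the circuit
(`IsSingleFaultRun.exists_error`). If each fibre meets each code block in a correctable set, the
circuit is therefore fault-tolerant as soon as it implements the gate
(`FaultTolerant.of_labelling`). The fibres are the positions in the code block, the Steane qubits,
or the positions in the Reed-Muller blocks.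

*The circuits.* `S` and `CNOT` are transversal, by the weights of the codewords modulo `4` and by
linearity. As the Steane rows have even overlap with `{1, 2, 7}`, the sum of the three Reed-Muller
blocks is a Reed-Muller word that encodes the logical qubit. Its weight modulo `8` gives `T`; and
`CCZ` comes from the fact that a product of three polynomials of degree at most one on `(ℤ/2)^4` has
values summing to zero. For `H`, each Reed-Muller block is decoded, rotated and encoded again. This
circuit equals `(X' + Z') / √2` for logical operators `X'`, `Z'` of the block, so it acts as `H` on
the Steane qubit, and `H` on all seven qubits is the logical `H` of the self-dual Steane code.
-/

noncomputable section

/-! ### Signs and characters of `ZMod 2` -/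

lemma zmod2_eq_zero_or_one (a : ZMod 2) : a = 0 ∨ a = 1 := by
  revert a; decide

lemma bitSign_zero : bitSign 0 = 1 := by simp [bitSign]

lemma bitSign_one : bitSign 1 = -1 := by simp [bitSign, ZMod.val_one]

lemma bitSign_add (a b : ZMod 2) : bitSign (a + b) = bitSign a * bitSign b := by
  rcases zmod2_eq_zero_or_one a with rfl | rfl <;>
    rcases zmod2_eq_zero_or_one b with rfl | rfl <;>
    simp [bitSign_zero, bitSign_one, CharTwo.add_self_eq_zero (1 : ZMod 2)]

lemma bitSign_mul_self (a : ZMod 2) : bitSign a * bitSign a = 1 := by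
  rw [← bitSign_add, CharTwo.add_self_eq_zero, bitSign_zero]

lemma bitSign_sum {ι : Type} (s : Finset ι) (f : ι → ZMod 2) :
    bitSign (∑ i ∈ s, f i) = ∏ i ∈ s, bitSign (f i) := by
  classical
  induction s using Finset.induction_on with
  | empty => simp [bitSign_zero]
  | insert a s ha ih => rw [Finset.sum_insert ha, Finset.prod_insert ha, bitSign_add, ih]

lemma star_bitSign (a : ZMod 2) : star (bitSign a) = bitSign a := by simp [bitSign]

/-- Orthogonality of the characters of `(ℤ/2)^n`. -/
lemma sum_bitSign_dotProduct {ι : Type} [Fintype ι] [DecidableEq ι] (v : ι → ZMod 2) :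
    ∑ u : ι → ZMod 2, bitSign (u ⬝ᵥ v) = if v = 0 then (2 : ℂ) ^ Fintype.card ι else 0 := by
  have h : ∑ u : ι → ZMod 2, bitSign (u ⬝ᵥ v) = ∏ i, ∑ a : ZMod 2, bitSign (a * v i) := by
    rw [Finset.prod_univ_sum, Fintype.piFinset_univ]
    exact Finset.sum_congr rfl fun u _ => bitSign_sum _ _
  have h2 : ∀ b : ZMod 2, ∑ a : ZMod 2, bitSign (a * b) = if b = 0 then 2 else 0 := by
    intro b
    have : ∀ f : ZMod 2 → ℂ, ∑ a : ZMod 2, f a = f 0 + f 1 := Fin.sum_univ_two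
    rw [this]
    rcases zmod2_eq_zero_or_one b with rfl | rfl
    · norm_num [bitSign_zero]
    · norm_num [bitSign_zero, bitSign_one]
  rw [h]
  simp only [h2]
  split_ifs with hv
  · simp [hv]
  · obtain ⟨i, hi⟩ := Function.ne_iff.mp hv
    exact Finset.prod_eq_zero (Finset.mem_univ i) (if_neg hi)

/-! ### Pauli operators -/

lemma dotProduct_eq_zero_of_disjoint {ι : Type} [Fintype ι] {S T : Set ι} (hST : Disjoint S T)
    {a b : ι → ZMod 2} (ha : ∀ q ∉ S, a q = 0) (hb : ∀ q ∉ T, b q = 0) : a ⬝ᵥ b = 0 := by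
  refine Finset.sum_eq_zero fun q _ => ?_
  by_cases hq : q ∈ S
  · rw [hb q fun h => Set.disjoint_left.mp hST hq h, mul_zero]
  · rw [ha q hq, zero_mul]

section Pauli
variable {ι : Type} [Fintype ι] [DecidableEq ι] {m : Type}

lemma vec_add_self {α : Type} (a : α → ZMod 2) : a + a = 0 := by
  ext i; exact CharTwo.add_self_eq_zero _

lemma vec_eq_add_iff {α : Type} {x y a : α → ZMod 2} : x = y + a ↔ y = x + a := by
  constructor <;> rintro rfl <;> rw [add_assoc, vec_add_self, add_zero]

lemma pauliX_mul_apply (a : ι → ZMod 2) (M : Matrix (ι → ZMod 2) m ℂ) (x : ι → ZMod 2) (y : m) :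
    (pauliX a * M) x y = M (x + a) y := by
  simp [pauliX, Matrix.mul_apply, vec_eq_add_iff]

lemma mul_pauliX_apply (a : ι → ZMod 2) (M : Matrix m (ι → ZMod 2) ℂ) (x : m) (y : ι → ZMod 2) :
    (M * pauliX a) x y = M x (y + a) := by
  simp [pauliX, Matrix.mul_apply]

lemma pauliZ_mul_apply (b : ι → ZMod 2) (M : Matrix (ι → ZMod 2) m ℂ) (x : ι → ZMod 2) (y : m) :
    (pauliZ b * M) x y = bitSign (b ⬝ᵥ x) * M x y := by
  simp [pauliZ]

lemma mul_pauliZ_apply (b : ι → ZMod 2) (M : Matrix m (ι → ZMod 2) ℂ) (x : m) (y : ι → ZMod 2) :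
    (M * pauliZ b) x y = M x y * bitSign (b ⬝ᵥ y) := by
  simp [pauliZ]

lemma pauliX_add (a b : ι → ZMod 2) : pauliX (a + b) = pauliX a * pauliX b := by
  ext x y
  rw [pauliX_mul_apply]
  simp only [pauliX, Matrix.of_apply]
  congr 1
  rw [eq_iff_iff, vec_eq_add_iff, vec_eq_add_iff (y := y), ← add_assoc, eq_comm]

lemma pauliZ_add (a b : ι → ZMod 2) : pauliZ (a + b) = pauliZ a * pauliZ b := by
  simp [pauliZ, add_dotProduct, bitSign_add]

lemma pauliX_zero : pauliX (0 : ι → ZMod 2) = 1 := by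
  ext x y; simp [pauliX, Matrix.one_apply]

lemma pauliZ_zero : pauliZ (0 : ι → ZMod 2) = 1 := by
  simp [pauliZ, bitSign_zero]

lemma pauliX_conjTranspose (a : ι → ZMod 2) : (pauliX a)ᴴ = pauliX a := by
  ext x y
  simp only [pauliX, Matrix.conjTranspose_apply, Matrix.of_apply]
  rw [apply_ite star, star_one, star_zero]
  exact if_congr vec_eq_add_iff rfl rfl

lemma pauliZ_conjTranspose (b : ι → ZMod 2) : (pauliZ b)ᴴ = pauliZ b := by
  rw [pauliZ, Matrix.diagonal_conjTranspose]
  congr 1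
  ext x
  exact star_bitSign _

lemma pauliZ_mul_pauliX (a b : ι → ZMod 2) :
    pauliZ b * pauliX a = bitSign (b ⬝ᵥ a) • (pauliX a * pauliZ b) := by
  ext x y
  rw [Matrix.smul_apply, pauliZ_mul_apply, mul_pauliZ_apply]
  simp only [pauliX, Matrix.of_apply]
  split_ifs with h
  · rw [h, dotProduct_add, bitSign_add]; simp [mul_comm]
  · simp

lemma pauliX_mul_pauliZ (a b : ι → ZMod 2) :
    pauliX a * pauliZ b = bitSign (b ⬝ᵥ a) • (pauliZ b * pauliX a) := by
  rw [pauliZ_mul_pauliX, smul_smul, bitSign_mul_self, one_smul]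

/-! ### Operators as combinations of Pauli operators -/

/-- The Pauli operators `X^a Z^b` on the qubits in `S`. -/
def paulisOn (S : Set ι) : Set (Op ι) :=
  {E | ∃ a b : ι → ZMod 2, (∀ q ∉ S, a q = 0) ∧ (∀ q ∉ S, b q = 0) ∧ E = pauliX a * pauliZ b}

/-- The span of the Pauli operators on the qubits in `S`: the algebra of all operators that act on
these qubits only. -/
def pauliSpan (S : Set ι) : Submodule ℂ (Op ι) := Submodule.span ℂ (paulisOn S)

lemma pauliX_mul_pauliZ_mem {S : Set ι} {a b : ι → ZMod 2} (ha : ∀ q ∉ S, a q = 0)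
    (hb : ∀ q ∉ S, b q = 0) : pauliX a * pauliZ b ∈ pauliSpan S :=
  Submodule.subset_span ⟨a, b, ha, hb, rfl⟩

lemma pauliX_mem {S : Set ι} {a : ι → ZMod 2} (ha : ∀ q ∉ S, a q = 0) : pauliX a ∈ pauliSpan S := by
  simpa [pauliZ_zero] using pauliX_mul_pauliZ_mem (b := 0) ha (fun _ _ => rfl)

lemma pauliZ_mem {S : Set ι} {b : ι → ZMod 2} (hb : ∀ q ∉ S, b q = 0) : pauliZ b ∈ pauliSpan S := by
  simpa [pauliX_zero] using pauliX_mul_pauliZ_mem (a := 0) (fun _ _ => rfl) hb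

lemma one_mem_pauliSpan (S : Set ι) : (1 : Op ι) ∈ pauliSpan S := by
  simpa [pauliX_zero] using pauliX_mem (S := S) (a := 0) (fun _ _ => rfl)

lemma pauliSpan_mono {S T : Set ι} (h : S ⊆ T) : pauliSpan S ≤ pauliSpan T :=
  Submodule.span_mono fun _ ⟨a, b, ha, hb, hE⟩ =>
    ⟨a, b, fun q hq => ha q fun h' => hq (h h'), fun q hq => hb q fun h' => hq (h h'), hE⟩

lemma mul_mem_pauliSpan {S : Set ι} {E F : Op ι} (hE : E ∈ pauliSpan S) (hF : F ∈ pauliSpan S) :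
    E * F ∈ pauliSpan S := by
  have h : pauliSpan S * pauliSpan S ≤ pauliSpan S := by
    rw [pauliSpan, Submodule.span_mul_span, Submodule.span_le]
    rintro _ ⟨_, ⟨a, b, ha, hb, rfl⟩, _, ⟨a', b', ha', hb', rfl⟩, rfl⟩
    have e : pauliX a * pauliZ b * (pauliX a' * pauliZ b') =
        bitSign (b ⬝ᵥ a') • (pauliX (a + a') * pauliZ (b + b')) := by
      rw [mul_assoc, ← mul_assoc (pauliZ b), pauliZ_mul_pauliX, pauliX_add, pauliZ_add]
      simp only [Matrix.smul_mul, Matrix.mul_smul, mul_assoc]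
    simp only [SetLike.mem_coe]
    rw [e]
    refine Submodule.smul_mem _ _ (pauliX_mul_pauliZ_mem ?_ ?_) <;> intro q hq <;>
      simp [ha q hq, ha' q hq, hb q hq, hb' q hq]
  exact h (Submodule.mul_mem_mul hE hF)

lemma commute_of_disjoint {S T : Set ι} (hST : Disjoint S T) {E F : Op ι}
    (hE : E ∈ pauliSpan S) (hF : F ∈ pauliSpan T) : E * F = F * E := by
  induction hE using Submodule.span_induction with
  | zero => simp
  | add x y _ _ hx hy => rw [add_mul, mul_add, hx, hy]
  | smul c x _ hx => rw [Matrix.smul_mul, Matrix.mul_smul, hx]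
  | mem x hx =>
    obtain ⟨a, b, ha, hb, rfl⟩ := hx
    induction hF using Submodule.span_induction with
    | zero => simp
    | add x y _ _ hx hy => rw [add_mul, mul_add, hx, hy]
    | smul c x _ hx => rw [Matrix.smul_mul, Matrix.mul_smul, hx]
    | mem y hy =>
      obtain ⟨a', b', ha', hb', rfl⟩ := hy
      have h1 : pauliZ b * pauliX a' = pauliX a' * pauliZ b := by
        rw [pauliZ_mul_pauliX, dotProduct_eq_zero_of_disjoint hST hb ha', bitSign_zero, one_smul]
      have h2 : pauliZ b' * pauliX a = pauliX a * pauliZ b' := by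
        rw [pauliZ_mul_pauliX, dotProduct_comm, dotProduct_eq_zero_of_disjoint hST ha hb',
          bitSign_zero, one_smul]
      rw [mul_assoc, ← mul_assoc (pauliZ b), h1, mul_assoc (pauliX a'), ← mul_assoc (pauliX a),
        ← pauliX_add, ← pauliZ_add, mul_assoc (pauliX a'), ← mul_assoc (pauliZ b'), h2,
        mul_assoc (pauliX a), ← mul_assoc (pauliX a'), ← pauliX_add, ← pauliZ_add,
        add_comm a, add_comm b]

/-- Every operator that acts on the qubits in `S` only is a combination of Pauli operators on
these qubits. -/
lemma SupportedOn.mem_pauliSpan {S : Set ι} {E : Op ι} (hE : SupportedOn S E) :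
    E ∈ pauliSpan S := by
  classical
  obtain ⟨A, hA⟩ := hE
  -- extension by zero of a bit string on `S`
  let ext : (S → ZMod 2) → ι → ZMod 2 := fun w q => if h : q ∈ S then w ⟨q, h⟩ else 0
  have ext_off : ∀ w, ∀ q ∉ S, ext w q = 0 := fun w q hq => by simp [ext, hq]
  have ext_on : ∀ w (q : S), ext w q = w q := fun w q => by simp [ext]
  have ext_dot : ∀ w x, ext w ⬝ᵥ x = w ⬝ᵥ (fun q : S => x q) := by
    intro w x
    simp only [dotProduct]
    rw [← Finset.sum_subset (Finset.subset_univ S.toFinset)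
      (fun q _ hq => by rw [ext_off w q (by simpa using hq), zero_mul]),
      Finset.sum_subtype (p := (· ∈ S)) S.toFinset (by simp)]
    exact Finset.sum_congr rfl fun q _ => by rw [ext_on]
  -- diagonal part: the Fourier expansion on `S`
  have key : E = ∑ c : S → ZMod 2, ∑ w : S → ZMod 2, ∑ b : S → ZMod 2,
      (A (w + c) w * ((2 : ℂ) ^ Fintype.card S)⁻¹ * bitSign (b ⬝ᵥ w)) •
        (pauliX (ext c) * pauliZ (ext b)) := by
    ext x y
    have hb : ∀ c w, ∑ b : S → ZMod 2, (A (w + c) w * ((2 : ℂ) ^ Fintype.card S)⁻¹ *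
        bitSign (b ⬝ᵥ w)) • (pauliX (ext c) * pauliZ (ext b)) x y =
        if w = (fun q : S => y q) then (if x = y + ext c then A (w + c) w else 0) else 0 := by
      intro c w
      have h1 : ∀ b : S → ZMod 2, (A (w + c) w * ((2 : ℂ) ^ Fintype.card S)⁻¹ *
          bitSign (b ⬝ᵥ w)) • (pauliX (ext c) * pauliZ (ext b)) x y =
          ((if x = y + ext c then A (w + c) w else 0) * ((2 : ℂ) ^ Fintype.card S)⁻¹) *
            bitSign (b ⬝ᵥ (w + fun q : S => y q)) := by
        intro b
        rw [mul_pauliZ_apply, ext_dot, dotProduct_add, bitSign_add]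
        simp only [pauliX, Matrix.of_apply, smul_eq_mul]
        split_ifs <;> ring
      rw [Finset.sum_congr rfl fun b _ => h1 b, ← Finset.mul_sum, sum_bitSign_dotProduct]
      have h2 : w + (fun q : S => y q) = 0 ↔ w = fun q : S => y q := by
        rw [eq_comm, ← zero_add (fun q : S => y q), ← vec_eq_add_iff (x := w), zero_add]
      simp only [h2]
      split_ifs <;> simp
    simp only [Matrix.sum_apply, Matrix.smul_apply, hb]
    simp only [Finset.sum_ite_eq', Finset.mem_univ, if_true]
    by_cases hxy : ∀ q, q ∉ S → x q = y q
    · rw [(hA x y).1 hxy, Finset.sum_eq_single ((fun q : S => x q) + fun q : S => y q)]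
      · rw [if_pos, add_comm (fun q : S => x q), ← add_assoc, vec_add_self, zero_add]
        ext q
        by_cases hq : q ∈ S
        · have := ext_on ((fun q : S => x q) + fun q : S => y q) ⟨q, hq⟩
          simp only [Pi.add_apply] at this ⊢
          rw [this, add_comm (x q), ← add_assoc, CharTwo.add_self_eq_zero, zero_add]
        · rw [Pi.add_apply, ext_off _ q hq, add_zero, hxy q hq]
      · intro c _ hc
        refine if_neg fun h => hc ?_
        ext q
        rw [Pi.add_apply, h, Pi.add_apply, ext_on, add_right_comm, CharTwo.add_self_eq_zero,
          zero_add]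
      · simp
    · rw [(hA x y).2 hxy, eq_comm]
      refine Finset.sum_eq_zero fun c _ => if_neg ?_
      rintro rfl
      exact hxy fun q hq => by rw [Pi.add_apply, ext_off c q hq, add_zero]
  rw [key]
  exact Submodule.sum_mem _ fun c _ => Submodule.sum_mem _ fun w _ => Submodule.sum_mem _
    fun b _ => Submodule.smul_mem _ _ (pauliX_mul_pauliZ_mem (ext_off c) (ext_off b))

end Pauli

/-! ### Projections onto syndrome spaces -/

section Projection
variable {n m P : Type} [Fintype P] [DecidableEq P]

/-- The projection onto the joint eigenspace with eigenvalues `(-1)^(s i)` of the commuting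
involutions generated by the representation `U` of `(ℤ/2)^P`. -/
def synProj (U : (P → ZMod 2) → Matrix n n ℂ) (s : P → ZMod 2) : Matrix n n ℂ :=
  ((2 : ℂ) ^ Fintype.card P)⁻¹ • ∑ u : P → ZMod 2, bitSign (s ⬝ᵥ u) • U u

variable {U : (P → ZMod 2) → Matrix n n ℂ}

lemma sum_synProj [DecidableEq n] (h0 : U 0 = 1) : ∑ s, synProj U s = 1 := by
  simp only [synProj]
  rw [← Finset.smul_sum, Finset.sum_comm]
  simp only [← Finset.sum_smul, sum_bitSign_dotProduct]
  simp [h0, smul_smul]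

lemma synProj_conjTranspose (hU : ∀ u, (U u)ᴴ = U u) (s : P → ZMod 2) :
    (synProj U s)ᴴ = synProj U s := by
  simp only [synProj, Matrix.conjTranspose_smul, Matrix.conjTranspose_sum, hU, star_bitSign]
  simp

lemma synProj_mul_self [Fintype n] (hadd : ∀ u v, U (u + v) = U u * U v) (s : P → ZMod 2) :
    synProj U s * synProj U s = synProj U s := by
  have h : ∀ u, (bitSign (s ⬝ᵥ u) • U u) * ∑ v, bitSign (s ⬝ᵥ v) • U v =
      ∑ v, bitSign (s ⬝ᵥ v) • U v := by
    intro u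
    rw [Finset.mul_sum, ← Equiv.sum_comp (Equiv.addLeft u) (fun v => bitSign (s ⬝ᵥ v) • U v)]
    refine Finset.sum_congr rfl fun v _ => ?_
    rw [Equiv.coe_addLeft, hadd, dotProduct_add, bitSign_add, Matrix.smul_mul, Matrix.mul_smul,
      smul_smul]
  simp only [synProj]
  rw [Matrix.smul_mul, Matrix.mul_smul, Finset.sum_mul, Finset.sum_congr rfl fun u _ => h u,
    Finset.sum_const, Finset.card_univ, Fintype.card_fun, ZMod.card, ← Nat.cast_smul_eq_nsmul ℂ,
    smul_smul, smul_smul]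
  congr 1
  push_cast
  field_simp

/-- An operator that commutes with the generators up to the signs `(-1)^(e i)` shifts the syndrome
by `e`. -/
lemma synProj_mul_comm [Fintype n] {Q : Matrix n n ℂ} {e : P → ZMod 2}
    (h : ∀ u, U u * Q = bitSign (e ⬝ᵥ u) • (Q * U u)) (s : P → ZMod 2) :
    synProj U s * Q = Q * synProj U (s + e) := by
  simp only [synProj]
  rw [Matrix.smul_mul, Matrix.mul_smul, Finset.sum_mul, Finset.mul_sum]
  congr 1
  refine Finset.sum_congr rfl fun u _ => ?_
  rw [Matrix.smul_mul, Matrix.mul_smul, h, smul_smul, add_dotProduct, bitSign_add]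

/-- States fixed by all generators have syndrome `0`. -/
lemma synProj_mul_of_fixed [Fintype n] {V : Matrix n m ℂ} (h : ∀ u, U u * V = V)
    (s : P → ZMod 2) : synProj U s * V = if s = 0 then V else 0 := by
  simp only [synProj]
  rw [Matrix.smul_mul, Matrix.sum_mul]
  simp only [Matrix.smul_mul, h]
  rw [← Finset.sum_smul]
  simp only [dotProduct_comm s, sum_bitSign_dotProduct, smul_smul]
  split_ifs <;> simp

end Projection

/-! ### Gates and circuits -/

section Gates

section
variable {ι : Type} [DecidableEq ι]

lemma eq_add_single_iff {x y : ι → ZMod 2} {q : ι} :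
    x = y + Pi.single q 1 ↔ (∀ p, p ≠ q → x p = y p) ∧ x q = y q + 1 := by
  constructor
  · rintro rfl
    exact ⟨fun p hp => by simp [hp], by simp⟩
  · rintro ⟨h1, h2⟩
    ext p
    by_cases hp : p = q
    · subst hp; simpa using h2
    · simpa [hp] using h1 p hp

lemma single_off {S : Set ι} {p : ι} (hp : p ∈ S) : ∀ q ∉ S, (Pi.single p 1 : ι → ZMod 2) q = 0 :=
  fun q hq => by
    rw [Pi.single_eq_of_ne]
    rintro rfl
    exact hq hp

lemma update_add_involutive {i j : ι} (hij : i ≠ j) {x y : ι → ZMod 2} :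
    x = Function.update y j (y j + y i) ↔ y = Function.update x j (x j + x i) := by
  constructor <;> rintro rfl <;> ext p <;> by_cases hp : p = j
  all_goals first
    | (subst hp; simp [hij, add_assoc, CharTwo.add_self_eq_zero])
    | simp [hp]

end

variable {ι : Type} [Fintype ι] [DecidableEq ι] {m : Type}

lemma circuitOp_append (C D : List (Gate ι)) :
    circuitOp (C ++ D) = circuitOp D * circuitOp C := by
  induction C with
  | nil => simp [circuitOp]
  | cons g C ih => simp [circuitOp, ih, mul_assoc]

lemma circuitOp_singleton (g : Gate ι) : circuitOp [g] = g.op := by simp [circuitOp]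

lemma pauliZ_single (q : ι) :
    pauliZ (Pi.single q 1) = Matrix.diagonal fun x : ι → ZMod 2 => bitSign (x q) := by
  simp [pauliZ]

/-- The Hadamard gate is `(X + Z) / √2`. -/
lemma Gate.op_h (q : ι) : (Gate.h q).op =
    ((Real.sqrt 2 : ℝ) : ℂ)⁻¹ • (pauliX (Pi.single q 1) + pauliZ (Pi.single q 1)) := by
  ext x y
  rw [pauliZ_single]
  simp only [Gate.op, Matrix.of_apply, Matrix.smul_apply, Matrix.add_apply, pauliX,
    Matrix.diagonal_apply, eq_add_single_iff, smul_eq_mul]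
  have hxy : x = y ↔ (∀ p, p ≠ q → x p = y p) ∧ x q = y q := by
    constructor
    · rintro rfl; simp
    · rintro ⟨h1, h2⟩
      ext p
      by_cases hp : p = q
      · rw [hp, h2]
      · exact h1 p hp
  rw [if_congr hxy rfl rfl]
  by_cases h : ∀ p, p ≠ q → x p = y p
  · rw [if_pos h]
    simp only [and_iff_right h]
    rcases zmod2_eq_zero_or_one (x q) with hx | hx <;>
      rcases zmod2_eq_zero_or_one (y q) with hy | hy <;>
      simp [hx, hy, bitSign_zero, bitSign_one, CharTwo.add_self_eq_zero (1 : ZMod 2)]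
  · simp [h]

lemma phaseGate_eq (q : ι) (z : ℂ) :
    phaseGate q z = ((1 + z) / 2) • (1 : Op ι) + ((1 - z) / 2) • pauliZ (Pi.single q 1) := by
  rw [pauliZ_single, phaseGate, ← Matrix.diagonal_one, ← Matrix.diagonal_smul,
    ← Matrix.diagonal_smul, Matrix.diagonal_add]
  congr 1
  ext x
  rcases zmod2_eq_zero_or_one (x q) with hx | hx <;> simp [hx, bitSign_zero, bitSign_one] <;> ring

lemma Gate.op_cnot (i j : ι) (hij : i ≠ j) : (Gate.cnot i j hij).op =
    (1 / 2 : ℂ) • (1 + pauliZ (Pi.single i 1)) +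
      (1 / 2 : ℂ) • (pauliX (Pi.single j 1) * (1 - pauliZ (Pi.single i 1))) := by
  ext x y
  rw [mul_sub, mul_one]
  simp only [Gate.op, Matrix.of_apply, Matrix.smul_apply, Matrix.add_apply, Matrix.sub_apply,
    mul_pauliZ_apply]
  rw [pauliZ_single]
  simp only [pauliX, Matrix.of_apply, Matrix.diagonal_apply, Matrix.one_apply, smul_eq_mul,
    single_one_dotProduct]
  rcases zmod2_eq_zero_or_one (y i) with hy | hy
  · rw [hy, add_zero, Function.update_eq_self]
    by_cases hxy : x = y
    · subst hxy; simp [hy, bitSign_zero]; norm_num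
    · simp [hxy, bitSign_zero]
  · have e : Function.update y j (y j + y i) = y + Pi.single j 1 := by
      rw [eq_add_single_iff]
      exact ⟨fun p hp => by simp [hp], by simp [hy]⟩
    rw [e]
    by_cases hxy : x = y
    · subst hxy
      simp [hy, bitSign_one]
    · simp only [hxy, hy, bitSign_one, if_false]
      ring

lemma Gate.op_ccz (i j k : ι) (hij : i ≠ j) (hik : i ≠ k) (hjk : j ≠ k) :
    (Gate.ccz i j k hij hik hjk).op = 1 - (1 / 4 : ℂ) • ((1 - pauliZ (Pi.single i 1)) *
      (1 - pauliZ (Pi.single j 1)) * (1 - pauliZ (Pi.single k 1))) := by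
  rw [pauliZ_single, pauliZ_single, pauliZ_single, Gate.op, ← Matrix.diagonal_one,
    Matrix.diagonal_sub, Matrix.diagonal_sub, Matrix.diagonal_sub, Matrix.diagonal_mul_diagonal,
    Matrix.diagonal_mul_diagonal, ← Matrix.diagonal_smul, Matrix.diagonal_sub]
  congr 1
  ext x
  rcases zmod2_eq_zero_or_one (x i) with hi | hi <;>
    rcases zmod2_eq_zero_or_one (x j) with hj | hj <;>
    rcases zmod2_eq_zero_or_one (x k) with hk | hk <;>
    simp [hi, hj, hk, bitSign_zero, bitSign_one]
  norm_num

lemma Gate.op_mem_pauliSpan (g : Gate ι) : g.op ∈ pauliSpan g.support := by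
  have hph : ∀ (q : ι) (z : ℂ), phaseGate q z ∈ pauliSpan {q} := fun q z => by
    rw [phaseGate_eq]
    exact Submodule.add_mem _ (Submodule.smul_mem _ _ (one_mem_pauliSpan _))
      (Submodule.smul_mem _ _ (pauliZ_mem (single_off rfl)))
  cases g with
  | h q =>
    rw [Gate.op_h]
    exact Submodule.smul_mem _ _ (Submodule.add_mem _ (pauliX_mem (single_off rfl))
      (pauliZ_mem (single_off rfl)))
  | s q => exact hph q _
  | sdg q => exact hph q _
  | t q => exact hph q _
  | tdg q => exact hph q _
  | cnot i j hij =>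
    have hi : i ∈ (Gate.cnot i j hij).support := by simp [Gate.support]
    have hj : j ∈ (Gate.cnot i j hij).support := by simp [Gate.support]
    rw [Gate.op_cnot]
    refine Submodule.add_mem _ (Submodule.smul_mem _ _ (Submodule.add_mem _ (one_mem_pauliSpan _)
      (pauliZ_mem (single_off hi)))) (Submodule.smul_mem _ _ (mul_mem_pauliSpan
        (pauliX_mem (single_off hj)) (Submodule.sub_mem _ (one_mem_pauliSpan _)
      (pauliZ_mem (single_off hi)))))
  | ccz i j k hij hik hjk =>
    have h : ∀ q ∈ (Gate.ccz i j k hij hik hjk).support, 1 - pauliZ (Pi.single q 1) ∈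
        pauliSpan (Gate.ccz i j k hij hik hjk).support := fun q hq =>
      Submodule.sub_mem _ (one_mem_pauliSpan _) (pauliZ_mem (single_off hq))
    rw [Gate.op_ccz]
    refine Submodule.sub_mem _ (one_mem_pauliSpan _) (Submodule.smul_mem _ _
      (mul_mem_pauliSpan (mul_mem_pauliSpan (h i ?_) (h j ?_)) (h k ?_))) <;> simp [Gate.support]

lemma cnot_mul_apply {i j : ι} (hij : i ≠ j) (M : Matrix (ι → ZMod 2) m ℂ) (x : ι → ZMod 2)
    (y : m) : ((Gate.cnot i j hij).op * M) x y = M (Function.update x j (x j + x i)) y := by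
  have h : ∀ z, (Gate.cnot i j hij).op x z =
      if z = Function.update x j (x j + x i) then 1 else 0 :=
    fun z => if_congr (update_add_involutive hij) rfl rfl
  simp [Matrix.mul_apply, h]

lemma mul_cnot_apply {i j : ι} (hij : i ≠ j) (M : Matrix m (ι → ZMod 2) ℂ) (x : m)
    (y : ι → ZMod 2) :
    (M * (Gate.cnot i j hij).op) x y = M x (Function.update y j (y j + y i)) := by
  simp [Gate.op, Matrix.mul_apply]

lemma cnot_mul_self {i j : ι} (hij : i ≠ j) :
    (Gate.cnot i j hij).op * (Gate.cnot i j hij).op = 1 := by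
  ext x y
  have h := (cnot_mul_apply hij ((Gate.cnot i j hij).op * 1) x y).trans (cnot_mul_apply hij 1 _ y)
  rw [← (update_add_involutive hij).mp rfl, mul_one] at h
  exact h

lemma phaseGate_mul (q : ι) (z w : ℂ) : phaseGate q z * phaseGate q w = phaseGate q (z * w) := by
  simp only [phaseGate, Matrix.diagonal_mul_diagonal]
  congr 1
  ext x
  split_ifs <;> simp

lemma phaseGate_one (q : ι) : phaseGate q 1 = 1 := by simp [phaseGate]

lemma sqrt_two_inv_sq : ((Real.sqrt 2 : ℝ) : ℂ)⁻¹ * ((Real.sqrt 2 : ℝ) : ℂ)⁻¹ = 1 / 2 := by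
  rw [← mul_inv, ← Complex.ofReal_mul, Real.mul_self_sqrt (by norm_num)]
  norm_num

/-- The inverse of a gate acts on the same qubits. -/
lemma Gate.exists_inverse (g : Gate ι) : ∃ E ∈ pauliSpan g.support, E * g.op = 1 := by
  have hph : ∀ (q : ι) (z w : ℂ), z * w = 1 → ∃ E ∈ pauliSpan {q}, E * phaseGate q w = 1 :=
    fun q z w h => ⟨phaseGate q z, by
      rw [phaseGate_eq]
      exact Submodule.add_mem _ (Submodule.smul_mem _ _ (one_mem_pauliSpan _))
        (Submodule.smul_mem _ _ (pauliZ_mem (single_off rfl))), by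
      rw [phaseGate_mul, h, phaseGate_one]⟩
  cases g with
  | h q =>
    refine ⟨_, Gate.op_mem_pauliSpan (Gate.h q), ?_⟩
    have hZX := pauliZ_mul_pauliX (Pi.single q 1 : ι → ZMod 2) (Pi.single q 1)
    rw [single_one_dotProduct, Pi.single_eq_same, bitSign_one, neg_one_smul] at hZX
    rw [Gate.op_h, Matrix.smul_mul, Matrix.mul_smul, smul_smul, sqrt_two_inv_sq, add_mul, mul_add,
      mul_add, ← pauliX_add, ← pauliZ_add, vec_add_self, pauliX_zero, pauliZ_zero, hZX,
      show ∀ A : Op ι, 1 + A + (-A + 1) = (2 : ℂ) • 1 from fun A => by rw [two_smul]; abel,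
      smul_smul]
    norm_num
  | s q => exact hph q (-Complex.I) _ (by simp)
  | sdg q => exact hph q Complex.I _ (by simp)
  | t q => exact hph q (Complex.exp (-(Complex.I * (Real.pi : ℂ) / 4))) _ (by
      rw [← Complex.exp_add]; simp)
  | tdg q => exact hph q (Complex.exp (Complex.I * (Real.pi : ℂ) / 4)) _ (by
      rw [← Complex.exp_add]; simp)
  | cnot i j hij => exact ⟨_, Gate.op_mem_pauliSpan (Gate.cnot i j hij), cnot_mul_self hij⟩
  | ccz i j k hij hik hjk =>
    refine ⟨_, Gate.op_mem_pauliSpan (Gate.ccz i j k hij hik hjk), ?_⟩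
    simp only [Gate.op, Matrix.diagonal_mul_diagonal, ← Matrix.diagonal_one]
    congr 1
    ext x
    split_ifs <;> simp

/-! ### Spread of faults

If every gate of a circuit acts within one fibre of a labelling of the qubits, then a fault within
a fibre stays within this fibre. -/

lemma exists_commute_past_gate {β : Type} {L : ι → β} {g : Gate ι} {c : β}
    (hg : ∀ p ∈ g.support, L p = c) {b : β} {E : Op ι} (hE : E ∈ pauliSpan {p | L p = b}) :
    ∃ E' ∈ pauliSpan {p | L p = b}, g.op * E = E' * g.op := by
  by_cases hcb : c = b
  · subst hcb
    have hsub : g.support ⊆ {p | L p = c} := hg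
    obtain ⟨G, hG, hG1⟩ := g.exists_inverse
    refine ⟨g.op * E * G, mul_mem_pauliSpan (mul_mem_pauliSpan
      (pauliSpan_mono hsub g.op_mem_pauliSpan) hE) (pauliSpan_mono hsub hG), ?_⟩
    rw [mul_assoc _ G, hG1, mul_one]
  · refine ⟨E, hE, commute_of_disjoint ?_ g.op_mem_pauliSpan hE⟩
    exact Set.disjoint_left.mpr fun p hp hp' => hcb ((hg p hp).symm.trans hp')

lemma exists_commute_past_circuit {β : Type} {L : ι → β} {C : List (Gate ι)}
    (hC : ∀ g ∈ C, ∃ c, ∀ p ∈ g.support, L p = c) {b : β} {E : Op ι}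
    (hE : E ∈ pauliSpan {p | L p = b}) :
    ∃ E' ∈ pauliSpan {p | L p = b}, circuitOp C * E = E' * circuitOp C := by
  induction C generalizing E with
  | nil => exact ⟨E, hE, by simp [circuitOp]⟩
  | cons g C ih =>
    obtain ⟨c, hc⟩ := hC g (by simp)
    obtain ⟨E₁, hE₁, h₁⟩ := exists_commute_past_gate hc hE
    obtain ⟨E₂, hE₂, h₂⟩ := ih (fun g hg => hC g (by simp [hg])) hE₁
    exact ⟨E₂, hE₂, by rw [circuitOp, mul_assoc, h₁, ← mul_assoc, h₂, mul_assoc]⟩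

lemma IsSingleFaultRun.exists_error {β : Type} {L : ι → β} {C : List (Gate ι)}
    (hC : ∀ g ∈ C, ∃ c, ∀ p ∈ g.support, L p = c) {F : Op ι} (hF : IsSingleFaultRun C F) :
    ∃ b, ∃ E ∈ pauliSpan {p | L p = b}, F = E * circuitOp C := by
  obtain ⟨before, after, E, rfl, rfl, hE⟩ := hF
  have hE' : ∃ b, E ∈ pauliSpan {p | L p = b} := by
    rcases hE with ⟨q, hq⟩ | ⟨init, g, rfl, hg⟩
    · exact ⟨L q, pauliSpan_mono (by rintro _ rfl; rfl) hq.mem_pauliSpan⟩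
    · obtain ⟨c, hc⟩ := hC g (by simp)
      exact ⟨c, pauliSpan_mono (fun p hp => hc p hp) hg.mem_pauliSpan⟩
  obtain ⟨b, hb⟩ := hE'
  obtain ⟨E', hE', h⟩ := exists_commute_past_circuit
    (fun g hg => hC g (List.mem_append_right _ hg)) hb
  exact ⟨b, E', hE', by rw [h, circuitOp_append, mul_assoc]⟩

/-! ### Diagonal circuits -/

lemma phaseGate_eq_diagonal (q : ι) (z : ℂ) :
    phaseGate q z = Matrix.diagonal fun x : ι → ZMod 2 => z ^ (x q).val := by
  rw [phaseGate]
  congr 1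
  ext x
  rcases zmod2_eq_zero_or_one (x q) with hx | hx <;> simp [hx, ZMod.val_one]

lemma ccz_eq_diagonal (i j k : ι) (hij : i ≠ j) (hik : i ≠ k) (hjk : j ≠ k) :
    (Gate.ccz i j k hij hik hjk).op = Matrix.diagonal fun x => bitSign (x i * x j * x k) := by
  rw [Gate.op]
  congr 1
  ext x
  rcases zmod2_eq_zero_or_one (x i) with hi | hi <;>
    rcases zmod2_eq_zero_or_one (x j) with hj | hj <;>
    rcases zmod2_eq_zero_or_one (x k) with hk | hk <;>
    simp [hi, hj, hk, bitSign_zero, bitSign_one]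

lemma circuitOp_flatMap_diagonal {α : Type} (l : List α) (f : α → List (Gate ι))
    (d : α → (ι → ZMod 2) → ℂ) (h : ∀ a, circuitOp (f a) = Matrix.diagonal (d a)) :
    circuitOp (l.flatMap f) = Matrix.diagonal fun x => (l.map fun a => d a x).prod := by
  induction l with
  | nil => simp [circuitOp]
  | cons a l ih =>
    rw [List.flatMap_cons, circuitOp_append, ih, h, Matrix.diagonal_mul_diagonal]
    congr 1
    ext x
    rw [List.map_cons, List.prod_cons, mul_comm]

lemma circuitOp_flatMap_univ {α : Type} [Fintype α] (f : α → List (Gate ι))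
    (d : α → (ι → ZMod 2) → ℂ) (h : ∀ a, circuitOp (f a) = Matrix.diagonal (d a)) :
    circuitOp (Finset.univ.toList.flatMap f) = Matrix.diagonal fun x => ∏ a, d a x := by
  rw [circuitOp_flatMap_diagonal _ _ d h]
  simp only [Finset.prod_map_toList]

end Gates

/-! ### CSS encoders -/

section CSS
variable {R ι : Type} [Fintype R] [DecidableEq R] [Fintype ι] [DecidableEq ι] {r : R → ι → ZMod 2}

lemma cssEncoder_add_span (x : ι → ZMod 2) (w : R → ZMod 2) (l : ZMod 2) :
    cssEncoder r (x + ∑ i, w i • r i) l = cssEncoder r x l := by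
  simp only [cssEncoder, Matrix.of_apply]
  congr 1
  rw [← Equiv.sum_comp (Equiv.addRight w)]
  refine Finset.sum_congr rfl fun u _ => if_congr ?_ rfl rfl
  simp only [Equiv.coe_addRight, Pi.add_apply, add_smul, Finset.sum_add_distrib]
  rw [add_right_comm (∑ i, u i • r i), add_left_inj]

lemma cssEncoder_add_const (x : ι → ZMod 2) (l m : ZMod 2) :
    cssEncoder r (x + fun _ => m) l = cssEncoder r x (l + m) := by
  simp only [cssEncoder, Matrix.of_apply]
  congr 1
  refine Finset.sum_congr rfl fun u _ => if_congr ?_ rfl rfl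
  rw [eq_comm, vec_eq_add_iff, eq_comm, add_assoc]
  exact eq_comm

lemma exists_of_cssEncoder_ne_zero {x : ι → ZMod 2} {l : ZMod 2} (h : cssEncoder r x l ≠ 0) :
    ∃ u : R → ZMod 2, x = (∑ i, u i • r i) + fun _ => l := by
  obtain ⟨u, _, hu⟩ := Finset.exists_ne_zero_of_sum_ne_zero (right_ne_zero_of_mul h)
  exact ⟨u, by by_contra h'; exact hu (if_neg h')⟩

lemma pauliX_span_mul_cssEncoder (w : R → ZMod 2) :
    pauliX (∑ i, w i • r i) * cssEncoder r = cssEncoder r := by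
  ext x l
  rw [pauliX_mul_apply, cssEncoder_add_span]

lemma pauliZ_mul_cssEncoder {z : ι → ZMod 2} (hr : ∀ i, z ⬝ᵥ r i = 0) (h1 : ∑ q, z q = 0) :
    pauliZ z * cssEncoder r = cssEncoder r := by
  ext x l
  rw [pauliZ_mul_apply]
  by_cases h : cssEncoder r x l = 0
  · rw [h, mul_zero]
  · obtain ⟨u, rfl⟩ := exists_of_cssEncoder_ne_zero h
    have h2 : z ⬝ᵥ (fun _ => l) = 0 := by
      simp only [dotProduct, ← Finset.sum_mul, h1, zero_mul]
    rw [dotProduct_add, h2, dotProduct_sum]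
    simp [dotProduct_smul, hr, bitSign_zero]

lemma cssEncoder_isometry
    (h : ∀ (u : R → ZMod 2) (l : ZMod 2), (∑ i, u i • r i) + (fun _ => l) = 0 → u = 0 ∧ l = 0) :
    (cssEncoder r)ᴴ * cssEncoder r = 1 := by
  have hinj : ∀ (u u' : R → ZMod 2) (l l' : ZMod 2),
      (∑ i, u i • r i) + (fun _ => l) = (∑ i, u' i • r i) + (fun _ => l') ↔ u = u' ∧ l = l' := by
    refine fun u u' l l' => ⟨fun e => ?_, by rintro ⟨rfl, rfl⟩; rfl⟩
    have := h (u - u') (l - l') (by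
      simp only [Pi.sub_apply, sub_smul, Finset.sum_sub_distrib]
      rw [show (fun _ : ι => l - l') = (fun _ => l) - fun _ => l' from rfl, sub_add_sub_comm, e,
        sub_self])
    exact ⟨sub_eq_zero.mp this.1, sub_eq_zero.mp this.2⟩
  ext l l'
  simp only [Matrix.mul_apply, Matrix.conjTranspose_apply, cssEncoder, Matrix.of_apply, star_mul',
    star_pow, star_sum]
  have hs : star ((Real.sqrt 2 : ℝ) : ℂ)⁻¹ = ((Real.sqrt 2 : ℝ) : ℂ)⁻¹ := by
    rw [star_inv₀]; simp
  simp only [hs, apply_ite star, star_one, star_zero]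
  have e : ∀ x : ι → ZMod 2,
      ((Real.sqrt 2 : ℝ) : ℂ)⁻¹ ^ Fintype.card R *
        (∑ u : R → ZMod 2, if x = (∑ i, u i • r i) + (fun _ => l) then (1 : ℂ) else 0) *
      (((Real.sqrt 2 : ℝ) : ℂ)⁻¹ ^ Fintype.card R *
        (∑ u : R → ZMod 2, if x = (∑ i, u i • r i) + (fun _ => l') then (1 : ℂ) else 0)) =
      (1 / 2) ^ Fintype.card R * ∑ u : R → ZMod 2, ∑ u' : R → ZMod 2,
        if x = (∑ i, u i • r i) + (fun _ => l) then
          (if x = (∑ i, u' i • r i) + (fun _ => l') then (1 : ℂ) else 0) else 0 := by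
    intro x
    rw [mul_mul_mul_comm, ← mul_pow, sqrt_two_inv_sq, Finset.sum_mul_sum]
    simp only [ite_mul, one_mul, zero_mul]
  rw [Finset.sum_congr rfl fun x _ => e x, ← Finset.mul_sum, Finset.sum_comm]
  have e2 : ∀ u : R → ZMod 2, ∑ x : ι → ZMod 2, ∑ u' : R → ZMod 2,
        (if x = (∑ i, u i • r i) + (fun _ => l) then
          (if x = (∑ i, u' i • r i) + (fun _ => l') then (1 : ℂ) else 0) else 0) =
        if l = l' then 1 else 0 := by
    intro u
    rw [Finset.sum_comm]
    simp only [Finset.sum_ite_eq', Finset.mem_univ, if_true, hinj]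
    by_cases hl : l = l' <;> simp [hl]
  rw [Finset.sum_congr rfl fun u _ => e2 u]
  simp only [Finset.sum_const, Finset.card_univ, Fintype.card_fun, ZMod.card, Matrix.one_apply]
  split_ifs
  · rw [nsmul_eq_mul, mul_one, Nat.cast_pow, ← mul_pow]; norm_num
  · simp

end CSS

/-! ### The concatenated code as a CSS code -/

/-- The encoder of the inner codes: a string of seven outer qubits is sent to Reed-Muller
codewords on the blocks in `B₁` and to itself on the bare qubits. -/
def innerEncoder : Matrix (Qubit49 → ZMod 2) (Fin 7 → ZMod 2) ℂ :=
  Matrix.of fun x y => ((Real.sqrt 2 : ℝ) : ℂ)⁻¹ ^ 12 *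
    ∑ u : {b : Fin 7 // b ∈ B₁} × Fin 4 → ZMod 2,
      if x = (∑ p, u p • innerCheck p.1 (rmRow p.2)) + (fun q => y q.outer) then 1 else 0

lemma sum_innerCheck_inl {K : Type} [Fintype K] (u : {b : Fin 7 // b ∈ B₁} × K → ZMod 2)
    (v : K → Fin 15 → ZMod 2) (b : {b : Fin 7 // b ∈ B₁}) (i : Fin 15) :
    (∑ p, u p • innerCheck p.1 (v p.2)) (.inl (b, i)) = ∑ k, u (b, k) * v k i := by
  rw [Finset.sum_apply, Fintype.sum_prod_type, Finset.sum_eq_single b]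
  · simp [innerCheck]
  · intro b' _ hb
    simp [innerCheck, hb.symm]
  · simp

lemma sum_innerCheck_inr {K : Type} [Fintype K] (u : {b : Fin 7 // b ∈ B₁} × K → ZMod 2)
    (v : K → Fin 15 → ZMod 2) (b : {b : Fin 7 // b ∉ B₁}) :
    (∑ p, u p • innerCheck p.1 (v p.2)) (.inr b) = 0 := by
  simp [Finset.sum_apply, innerCheck]

lemma boole_congr {p q : Prop} {_ : Decidable p} {_ : Decidable q} (h : p ↔ q) :
    (if p then (1 : ℂ) else 0) = if q then 1 else 0 := by
  by_cases hq : q <;> simp [h, hq]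

lemma boole_mul_boole_of_iff {p q r : Prop} {_ : Decidable p} {_ : Decidable q} {_ : Decidable r}
    (h : p ∧ q ↔ r) :
    (if p then (1 : ℂ) else 0) * (if q then 1 else 0) = if r then 1 else 0 := by
  by_cases hp : p <;> by_cases hq : q <;> simp [← h, hp, hq]

lemma encoder49_eq_mul : encoder49 = innerEncoder * steaneEncoder := by
  ext x l
  simp only [encoder49, Matrix.of_apply, Matrix.mul_apply]
  refine Finset.sum_congr rfl fun y _ => ?_
  rw [mul_comm]
  congr 1
  simp only [rmEncoder, cssEncoder, innerEncoder, Matrix.of_apply]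
  rw [Finset.prod_mul_distrib, Finset.prod_const, ← pow_mul, Finset.prod_univ_sum,
    Fintype.piFinset_univ, ← Equiv.sum_comp (Equiv.curry _ _ _), mul_assoc, Finset.sum_mul]
  congr 1
  refine Finset.sum_congr rfl fun u _ => ?_
  rw [Finset.prod_boole, Finset.prod_boole]
  refine boole_mul_boole_of_iff ?_
  simp only [Finset.mem_univ, true_implies]
  constructor
  · rintro ⟨h1, h2⟩
    ext q
    rcases q with ⟨b, i⟩ | b
    · rw [Pi.add_apply, sum_innerCheck_inl]
      have := congrFun (h1 b) i
      simpa [Finset.sum_apply, Qubit49.outer] using this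
    · rw [Pi.add_apply, sum_innerCheck_inr, zero_add, h2 b]; rfl
  · rintro rfl
    refine ⟨fun b => ?_, fun b => ?_⟩
    · ext i
      rw [Pi.add_apply, sum_innerCheck_inl]
      simp [Finset.sum_apply, Qubit49.outer]
    · rw [Pi.add_apply, sum_innerCheck_inr, zero_add]; rfl

/-- The concatenation is the CSS code of the concatenated generators. -/
lemma encoder49_eq_cssEncoder : encoder49 = cssEncoder xCheck := by
  rw [encoder49_eq_mul]
  ext x l
  simp only [innerEncoder, steaneEncoder, cssEncoder, Matrix.of_apply, Matrix.mul_apply]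
  have e : ∀ y : Fin 7 → ZMod 2,
      (((Real.sqrt 2 : ℝ) : ℂ)⁻¹ ^ 12 * ∑ u : {b : Fin 7 // b ∈ B₁} × Fin 4 → ZMod 2,
      if x = (∑ p, u p • innerCheck p.1 (rmRow p.2)) + (fun q => y q.outer) then 1 else 0) *
      (((Real.sqrt 2 : ℝ) : ℂ)⁻¹ ^ Fintype.card (Fin 3) *
        ∑ v : Fin 3 → ZMod 2, if y = (∑ i, v i • steaneRow i) + (fun _ => l) then 1 else 0) =
      ((Real.sqrt 2 : ℝ) : ℂ)⁻¹ ^ Fintype.card XIndex *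
        ∑ u : {b : Fin 7 // b ∈ B₁} × Fin 4 → ZMod 2, ∑ v : Fin 3 → ZMod 2,
          if y = (∑ i, v i • steaneRow i) + (fun _ => l) then
            (if x = (∑ p, u p • innerCheck p.1 (rmRow p.2)) + (fun q => y q.outer) then 1 else 0)
          else 0 := by
    intro y
    rw [mul_mul_mul_comm, ← pow_add, Finset.sum_mul_sum]
    congr 1
    refine Finset.sum_congr rfl fun u _ => Finset.sum_congr rfl fun v _ => ?_
    split_ifs <;> simp
  rw [Finset.sum_congr rfl fun y _ => e y, ← Finset.mul_sum, Finset.sum_comm,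
    ← Equiv.sum_comp (Equiv.sumArrowEquivProdArrow _ _ _).symm, Fintype.sum_prod_type]
  congr 1
  refine Finset.sum_congr rfl fun u _ => ?_
  rw [Finset.sum_comm]
  refine Finset.sum_congr rfl fun v _ => ?_
  rw [Finset.sum_ite_eq' Finset.univ, if_pos (Finset.mem_univ _)]
  refine if_congr ?_ rfl rfl
  rw [Fintype.sum_sum_type, add_assoc]
  have : (fun q : Qubit49 => ((∑ i, v i • steaneRow i) + (fun _ => l) : Fin 7 → ZMod 2) q.outer) =
      (∑ i, v i • outerCheck i) + fun _ => l := by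
    ext q
    simp [Finset.sum_apply, outerCheck]
  rw [this]
  rfl

/-- The shape of the basis states that occur in a codeword: Reed-Muller codewords on the blocks,
encoding a word of the Steane code. -/
lemma exists_of_encoder49_ne_zero {x : Qubit49 → ZMod 2} {l : ZMod 2} (h : encoder49 x l ≠ 0) :
    ∃ (u : {b : Fin 7 // b ∈ B₁} → Fin 4 → ZMod 2) (v : Fin 3 → ZMod 2),
      (∀ b i, x (.inl (b, i)) = ∑ k, u b k * rmRow k i + (∑ k, v k * steaneRow k b.1 + l)) ∧
      ∀ b, x (.inr b) = ∑ k, v k * steaneRow k b.1 + l := by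
  rw [encoder49_eq_cssEncoder] at h
  obtain ⟨u, rfl⟩ := exists_of_cssEncoder_ne_zero h
  refine ⟨fun b k => u (.inl (b, k)), fun k => u (.inr k), fun b i => ?_, fun b => ?_⟩
  · rw [Fintype.sum_sum_type]
    simp only [Pi.add_apply, xCheck]
    rw [sum_innerCheck_inl (fun p => u (.inl p)), add_assoc]
    simp [Finset.sum_apply, outerCheck, Qubit49.outer]
  · rw [Fintype.sum_sum_type]
    simp only [Pi.add_apply, xCheck]
    rw [sum_innerCheck_inr (fun p => u (.inl p)), zero_add]
    simp [Finset.sum_apply, outerCheck, Qubit49.outer]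

lemma rmRow_independent : ∀ (u : Fin 4 → ZMod 2) (l : ZMod 2),
    (∀ i, ∑ k, u k * rmRow k i + l = 0) → u = 0 ∧ l = 0 := by decide +kernel

lemma steaneRow_independent : ∀ (v : Fin 3 → ZMod 2) (l : ZMod 2),
    (∀ i, ∑ k, v k * steaneRow k i + l = 0) → v = 0 ∧ l = 0 := by decide +kernel

theorem encoder49_isometry : encoder49ᴴ * encoder49 = 1 := by
  rw [encoder49_eq_cssEncoder]
  refine cssEncoder_isometry fun u l h => ?_
  rw [Fintype.sum_sum_type] at h
  have hl : ∀ b, (fun k => u (.inl (b, k))) = 0 ∧ ∑ k, u (.inr k) * steaneRow k b.1 + l = 0 := by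
    refine fun b => rmRow_independent _ _ fun i => ?_
    have := congrFun h (.inl (b, i))
    simp only [Pi.add_apply, xCheck] at this
    rw [sum_innerCheck_inl (fun p => u (.inl p)), add_assoc] at this
    simpa [Finset.sum_apply, outerCheck, Qubit49.outer] using this
  have hr : ∀ b : {b : Fin 7 // b ∉ B₁}, ∑ k, u (.inr k) * steaneRow k b.1 + l = 0 := by
    intro b
    have := congrFun h (.inr b)
    simp only [Pi.add_apply, xCheck] at this
    rw [sum_innerCheck_inr (fun p => u (.inl p)), zero_add] at this
    simpa [Finset.sum_apply, outerCheck, Qubit49.outer] using this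
  have hs := steaneRow_independent (fun k => u (.inr k)) l fun b => by
    by_cases hb : b ∈ B₁
    · exact (hl ⟨b, hb⟩).2
    · exact hr ⟨b, hb⟩
  refine ⟨?_, hs.2⟩
  ext p
  rcases p with ⟨b, k⟩ | k
  · exact congrFun (hl b).1 k
  · exact congrFun hs.1 k

/-- The parities of a vector of physical qubits on the blocks of the seven outer qubits. -/
def blockParity (x : Qubit49 → ZMod 2) : Fin 7 → ZMod 2 :=
  fun b => ∑ q, if q.outer = b then x q else 0

lemma outerCheck_dotProduct (k : Fin 3) (x : Qubit49 → ZMod 2) :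
    outerCheck k ⬝ᵥ x = steaneRow k ⬝ᵥ blockParity x := by
  simp only [dotProduct, blockParity, outerCheck, Finset.mul_sum]
  rw [Finset.sum_comm]
  refine Finset.sum_congr rfl fun q _ => ?_
  simp

lemma innerCheck_dotProduct (b : {b : Fin 7 // b ∈ B₁}) (v : Fin 15 → ZMod 2)
    (x : Qubit49 → ZMod 2) : innerCheck b v ⬝ᵥ x = v ⬝ᵥ fun i => x (.inl (b, i)) := by
  simp only [dotProduct]
  rw [Fintype.sum_sum_type, Fintype.sum_prod_type, Finset.sum_eq_single b]
  · simp [innerCheck]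
  · intro b' _ hb
    simp [innerCheck, hb]
  · simp

lemma blockParity_block (x : Qubit49 → ZMod 2) (b : {b : Fin 7 // b ∈ B₁}) :
    blockParity x b = ∑ i, x (.inl (b, i)) := by
  rw [blockParity, Fintype.sum_sum_type, Fintype.sum_prod_type, Finset.sum_eq_single b]
  · rw [Finset.sum_eq_zero (s := (Finset.univ : Finset {b : Fin 7 // b ∉ B₁})), add_zero]
    · simp [Qubit49.outer]
    · intro b' _
      exact if_neg fun h => b'.2 (by rw [show b'.1 = b.1 from h]; exact b.2)
  · intro b' _ hb
    exact Finset.sum_eq_zero fun i _ => if_neg fun h => hb (Subtype.ext h)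
  · simp

lemma blockParity_bare (x : Qubit49 → ZMod 2) (b : {b : Fin 7 // b ∉ B₁}) :
    blockParity x b = x (.inr b) := by
  rw [blockParity, Fintype.sum_sum_type, Finset.sum_eq_zero, zero_add, Finset.sum_eq_single b]
  · simp [Qubit49.outer]
  · intro b' _ hb
    exact if_neg fun h => hb (Subtype.ext h)
  · simp
  · intro p _
    exact if_neg fun h => b.2 (by rw [← show p.1.1 = b.1 from h]; exact p.1.2)

lemma rmZRow_dotProduct_rmRow : ∀ (p : RMZIndex) (k : Fin 4), rmZRow p ⬝ᵥ rmRow k = 0 := by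
  decide +kernel

lemma sum_rmZRow : ∀ p : RMZIndex, ∑ i, rmZRow p i = 0 := by decide +kernel

lemma sum_rmRow : ∀ k : Fin 4, ∑ i, rmRow k i = 0 := by decide +kernel

lemma steaneRow_dotProduct_steaneRow : ∀ k l : Fin 3, steaneRow k ⬝ᵥ steaneRow l = 0 := by
  decide +kernel

lemma sum_steaneRow : ∀ k : Fin 3, ∑ i, steaneRow k i = 0 := by decide +kernel

lemma blockParity_outer (y : Fin 7 → ZMod 2) : blockParity (fun q => y q.outer) = y := by
  ext b
  by_cases hb : b ∈ B₁
  · rw [blockParity_block _ ⟨b, hb⟩]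
    simp only [Qubit49.outer, Finset.sum_const, Finset.card_univ, Fintype.card_fin]
    -- fifteen is odd
    rcases zmod2_eq_zero_or_one (y b) with h | h <;> rw [h] <;> decide
  · exact blockParity_bare _ ⟨b, hb⟩

lemma blockParity_innerCheck {v : Fin 15 → ZMod 2} (hv : ∑ i, v i = 0)
    (b : {b : Fin 7 // b ∈ B₁}) : blockParity (innerCheck b v) = 0 := by
  ext c
  by_cases hc : c ∈ B₁
  · rw [blockParity_block _ ⟨c, hc⟩]
    by_cases h : (⟨c, hc⟩ : {b : Fin 7 // b ∈ B₁}) = b <;> simp [innerCheck, h, hv]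
  · rw [blockParity_bare _ ⟨c, hc⟩]; rfl

lemma zCheck_dotProduct_xCheck (j : ZIndex) (i : XIndex) : zCheck j ⬝ᵥ xCheck i = 0 := by
  rcases j with ⟨b, p⟩ | j
  · rw [zCheck, innerCheck_dotProduct]
    rcases i with ⟨c, k⟩ | i
    · by_cases h : b = c
      · simp [xCheck, innerCheck, h, rmZRow_dotProduct_rmRow]
      · simp [xCheck, innerCheck, h]
    · simp only [xCheck, outerCheck, Qubit49.outer, dotProduct, ← Finset.sum_mul, sum_rmZRow,
        zero_mul]
  · rw [zCheck, outerCheck_dotProduct]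
    rcases i with ⟨c, k⟩ | i
    · rw [xCheck, blockParity_innerCheck (sum_rmRow k), dotProduct_zero]
    · exact (congrArg _ (blockParity_outer (steaneRow i))).trans
        (steaneRow_dotProduct_steaneRow j i)

lemma sum_zCheck (j : ZIndex) : ∑ q, zCheck j q = 0 := by
  have h1 : ∑ q, zCheck j q = zCheck j ⬝ᵥ fun _ => 1 := by simp [dotProduct]
  rw [h1]
  rcases j with ⟨b, p⟩ | j
  · rw [zCheck, innerCheck_dotProduct]
    simpa [dotProduct] using sum_rmZRow p
  · rw [zCheck, outerCheck_dotProduct]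
    refine (congrArg _ (blockParity_outer fun _ => 1)).trans ?_
    simpa [dotProduct] using sum_steaneRow j

lemma pauliX_span_mul_encoder49 (u : XIndex → ZMod 2) :
    pauliX (∑ i, u i • xCheck i) * encoder49 = encoder49 := by
  rw [encoder49_eq_cssEncoder, pauliX_span_mul_cssEncoder]

lemma pauliZ_span_mul_encoder49 (u : ZIndex → ZMod 2) :
    pauliZ (∑ j, u j • zCheck j) * encoder49 = encoder49 := by
  rw [encoder49_eq_cssEncoder]
  refine pauliZ_mul_cssEncoder (fun i => ?_) ?_
  · simp [sum_dotProduct, zCheck_dotProduct_xCheck]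
  · simp only [Finset.sum_apply, Pi.smul_apply, smul_eq_mul]
    rw [Finset.sum_comm]
    simp only [← Finset.mul_sum, sum_zCheck, mul_zero, Finset.sum_const_zero]

/-! ### Decoding of the classical codes -/

/-- Reconstruction of a vector with zero syndrome for the checks `h` and even weight from its
coordinates: `w = ∑ r, (U r ⬝ w) • G r`. The matrices `N` and `n` witness that the two sides differ
by a combination of the constraints. -/
lemma eq_span_of_identity {ι P R : Type} [Fintype ι] [DecidableEq ι] [Fintype P] [Fintype R]
    {h : P → ι → ZMod 2} {G U : R → ι → ZMod 2} (N : ι → P → ZMod 2) (n : ι → ZMod 2)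
    (hid : ∀ i j, (if i = j then 1 else 0) = ∑ r, U r j * G r i + ∑ p, N i p * h p j + n i)
    {w : ι → ZMod 2} (hw : ∀ p, h p ⬝ᵥ w = 0) (hw1 : ∑ i, w i = 0) :
    w = ∑ r, (U r ⬝ᵥ w) • G r := by
  ext i
  have e : ∀ j, (if i = j then 1 else 0) * w j =
      ∑ r, U r j * w j * G r i + ∑ p, N i p * (h p j * w j) + n i * w j := by
    intro j
    rw [hid i j, add_mul, add_mul, Finset.sum_mul, Finset.sum_mul]
    congr 2
    · exact Finset.sum_congr rfl fun r _ => by ring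
    · exact Finset.sum_congr rfl fun p _ => by ring
  calc w i = ∑ j, (if i = j then 1 else 0) * w j := by simp
    _ = ∑ r, (U r ⬝ᵥ w) * G r i + ∑ p, N i p * (h p ⬝ᵥ w) + n i * ∑ j, w j := by
      rw [Finset.sum_congr rfl fun j _ => e j, Finset.sum_add_distrib, Finset.sum_add_distrib,
        Finset.sum_comm, Finset.sum_comm (f := fun j p => N i p * (h p j * w j)), Finset.mul_sum]
      simp only [dotProduct, Finset.sum_mul, Finset.mul_sum]
    _ = _ := by simp [hw, hw1, Finset.sum_apply]

/-- Even vectors orthogonal to the four `X`-rows: Möbius inversion for polynomials of degree `2` on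
`(ℤ/2)^4`. The coefficient of a monomial is the sum of the values at the nonzero points below it;
it vanishes in degrees `3` and `4` by the constraints. -/
lemma exists_rmZRow_span {w : Fin 15 → ZMod 2} (hw : ∀ k, rmRow k ⬝ᵥ w = 0)
    (h1 : ∑ i, w i = 0) : ∃ u : RMZIndex → ZMod 2, w = ∑ p, u p • rmZRow p :=
  ⟨_, eq_span_of_identity
    (U := fun (p : RMZIndex) j => if (j.val + 1) ||| (2 ^ p.1.1.val ||| 2 ^ p.1.2.val) =
      2 ^ p.1.1.val ||| 2 ^ p.1.2.val then 1 else 0)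
    -- The sum of the values below the monomial of degree `3` without the variable `k` is the total sum
    -- minus `rmRow k ⬝ w`. It enters the value at `i` if the point `i` lies above this monomial.
    (fun i k => if (i.val + 1) ||| 2 ^ k.val = 15 then 1 else 0)
    (fun i => if ∃ k : Fin 4, (i.val + 1) ||| 2 ^ k.val = 15 then 1 else 0)
    (by decide +kernel) hw h1⟩

/-- Even vectors orthogonal to the ten `Z`-rows: Möbius inversion for polynomials of degree `1` on
`(ℤ/2)^4`, where the coefficients in degrees `2`, `3` and `4` vanish by the constraints. -/
lemma exists_rmRow_span {w : Fin 15 → ZMod 2} (hw : ∀ p, rmZRow p ⬝ᵥ w = 0)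
    (h1 : ∑ i, w i = 0) : ∃ u : Fin 4 → ZMod 2, w = ∑ k, u k • rmRow k :=
  ⟨_, eq_span_of_identity
    (U := fun k j => if j.val + 1 = 2 ^ k.val then 1 else 0)
    -- The sum of the values below a monomial is the product of `1 + rmRow k` over the missing
    -- variables `k`, paired with `w`. The coefficients below are those of the expanded products, summed
    -- modulo `2` over the monomials of degree at least `2` below the point `i`.
    (fun i p => if p.1.1 = p.1.2
      then if ∃ m n : Fin 4, m < n ∧ (i.val + 1) ||| 2 ^ p.1.1.val =
        2 ^ p.1.1.val ||| (2 ^ m.val ||| 2 ^ n.val) ∧ m ≠ p.1.1 ∧ n ≠ p.1.1 then 1 else 0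
      else if (i.val + 1) ||| (2 ^ p.1.1.val ||| 2 ^ p.1.2.val) = 15 then 1 else 0)
    (fun i => if (∃ m n : Fin 4, m < n ∧ i.val + 1 = 2 ^ m.val ||| 2 ^ n.val) ∨ i.val = 14
      then 1 else 0)
    (by decide +kernel) hw h1⟩

/-- A vector supported on two positions is zero if its syndrome is zero and the columns of the check
matrix are nonzero and distinct. -/
lemma eq_zero_of_two_positions {ι P : Type} [Fintype ι] [DecidableEq ι] {h : P → ι → ZMod 2}
    (h0 : ∀ i, ∃ p, h p i ≠ 0) (h1 : ∀ i j, i ≠ j → ∃ p, h p i ≠ h p j) {w : ι → ZMod 2} {i j : ι}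
    (hsupp : ∀ q, q ≠ i → q ≠ j → w q = 0) (hw : ∀ p, h p ⬝ᵥ w = 0) : w = 0 := by
  have one : ∀ k, (∀ q, q ≠ k → w q = 0) → w = 0 := by
    intro k hk
    obtain ⟨p, hp⟩ := h0 k
    have e := hw p
    rw [dotProduct, Finset.sum_eq_single k (fun q _ hq => by rw [hk q hq, mul_zero]) (by simp)] at e
    have := (mul_eq_zero.mp e).resolve_left hp
    ext q
    by_cases hq : q = k
    · rw [hq, this]; rfl
    · exact hk q hq
  by_cases hij : i = j
  · subst hij
    exact one i fun q hq => hsupp q hq hq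
  by_cases hi : w i = 0
  · refine one j fun q hq => ?_
    by_cases hqi : q = i
    · rw [hqi, hi]
    · exact hsupp q hqi hq
  by_cases hj : w j = 0
  · refine one i fun q hq => ?_
    by_cases hqj : q = j
    · rw [hqj, hj]
    · exact hsupp q hq hqj
  obtain ⟨p, hp⟩ := h1 i j hij
  have e := hw p
  rw [dotProduct, Fintype.sum_eq_add i j hij
    (fun q hq => by rw [hsupp q hq.1 hq.2, mul_zero]),
    (zmod2_eq_zero_or_one _).resolve_left hi, (zmod2_eq_zero_or_one _).resolve_left hj,
    mul_one, mul_one] at e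
  exact absurd (CharTwo.add_eq_zero.mp e) hp

lemma rmRow_column_ne_zero : ∀ i, ∃ k, rmRow k i ≠ 0 := by decide +kernel

lemma rmRow_column_injective : ∀ i j, i ≠ j → ∃ k, rmRow k i ≠ rmRow k j := by decide +kernel

lemma steaneRow_column_ne_zero : ∀ i, ∃ k, steaneRow k i ≠ 0 := by decide +kernel

lemma steaneRow_column_injective : ∀ i j, i ≠ j → ∃ k, steaneRow k i ≠ steaneRow k j := by
  decide +kernel

/-- The sets of qubits on which arbitrary errors are corrected: the physical qubits of one Steane
qubit, or the qubits at one position of the Reed-Muller blocks. -/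
inductive Correctable : Set Qubit49 → Prop
  | block {S : Set Qubit49} (b : Fin 7) (h : ∀ q ∈ S, q.outer = b) : Correctable S
  | column {S : Set Qubit49} (i : Fin 15) (h : ∀ q ∈ S, ∃ b, q = .inl (b, i)) : Correctable S

/-- Vectors with correctable support: the patterns of bit flips and of phase flips that the decoder
undoes. -/
def IsCorrectableError (a : Qubit49 → ZMod 2) : Prop :=
  ∃ S, Correctable S ∧ ∀ q ∉ S, a q = 0

/-- On each Reed-Muller block a column error is supported at one position. -/
lemma column_support {S : Set Qubit49} {i : Fin 15} (h : ∀ q ∈ S, ∃ b, q = .inl (b, i))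
    {a : Qubit49 → ZMod 2} (ha : ∀ q ∉ S, a q = 0) (b : {b : Fin 7 // b ∈ B₁}) (j : Fin 15)
    (hj : j ≠ i) : a (.inl (b, j)) = 0 :=
  ha _ fun hq => by
    obtain ⟨c, hc⟩ := h _ hq
    exact hj (by simpa using congrArg (fun q : Qubit49 => q.elim Prod.snd fun _ => j) hc)

lemma column_support_bare {S : Set Qubit49} {i : Fin 15} (h : ∀ q ∈ S, ∃ b, q = .inl (b, i))
    {a : Qubit49 → ZMod 2} (ha : ∀ q ∉ S, a q = 0) (b : {b : Fin 7 // b ∉ B₁}) :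
    a (.inr b) = 0 :=
  ha _ fun hq => by obtain ⟨c, hc⟩ := h _ hq; cases hc

lemma blockParity_eq_zero {x : Qubit49 → ZMod 2} {b : Fin 7}
    (h : ∀ q, q.outer = b → x q = 0) : blockParity x b = 0 :=
  Finset.sum_eq_zero fun q _ => by
    split_ifs with hq
    · exact h q hq
    · rfl

/-- The difference of a block error and a column error with zero syndrome lies in one block. -/
lemma block_column_support {S S' : Set Qubit49} {b : Fin 7} {i : Fin 15}
    (h : ∀ q ∈ S, q.outer = b) (h' : ∀ q ∈ S', ∃ b, q = .inl (b, i)) {a a' : Qubit49 → ZMod 2}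
    (ha : ∀ q ∉ S, a q = 0) (ha' : ∀ q ∉ S', a' q = 0)
    (hin : ∀ b k, rmRow k ⬝ᵥ (fun i => (a + a') (.inl (b, i))) = 0) (c : Fin 7) (hc : c ≠ b) :
    blockParity (a + a') c = 0 := by
  have hac : ∀ q, q.outer = c → a q = 0 := fun q hq =>
    ha q fun hS => hc (hq.symm.trans (h q hS))
  refine blockParity_eq_zero fun q hq => ?_
  rw [Pi.add_apply, hac q hq, zero_add]
  rcases q with ⟨d, j⟩ | d
  · have hz := eq_zero_of_two_positions rmRow_column_ne_zero rmRow_column_injective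
      (w := fun i => (a + a') (.inl (d, i))) (i := i) (j := i) (fun j hj _ => by
        simp only [Pi.add_apply]
        rw [hac (.inl (d, j)) hq, column_support h' ha' d j hj, add_zero]) (hin d)
    have := congrFun hz j
    simpa [hac (.inl (d, j)) hq] using this
  · exact column_support_bare h' ha' d

/-- Two correctable errors with the same syndrome differ by a vector of even weight on every block.
The inner code has distance three, so two column errors, or the parts of a column error outside a
block, are told apart by the Reed-Muller checks; two block errors are told apart by the Steane code,
which has distance three as well. -/
lemma blockParity_eq_zero_of_syndrome {a a' : Qubit49 → ZMod 2} (ha : IsCorrectableError a)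
    (ha' : IsCorrectableError a')
    (hin : ∀ b k, rmRow k ⬝ᵥ (fun i => (a + a') (.inl (b, i))) = 0)
    (hout : ∀ k, steaneRow k ⬝ᵥ blockParity (a + a') = 0) : blockParity (a + a') = 0 := by
  have two : ∀ b c : Fin 7, (∀ d, d ≠ b → d ≠ c → blockParity (a + a') d = 0) →
      blockParity (a + a') = 0 := fun b c hbc =>
    eq_zero_of_two_positions steaneRow_column_ne_zero steaneRow_column_injective hbc hout
  obtain ⟨S, hS, ha⟩ := ha
  obtain ⟨S', hS', ha'⟩ := ha'
  cases hS with
  | block b h =>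
    cases hS' with
    | block c h' =>
      refine two b c fun d hdb hdc => blockParity_eq_zero fun q hq => ?_
      rw [Pi.add_apply, ha q fun hS => hdb (hq.symm.trans (h q hS)),
        ha' q fun hS => hdc (hq.symm.trans (h' q hS)), add_zero]
    | column i h' => exact two b b fun d hd _ => block_column_support h h' ha ha' hin d hd
  | column i h =>
    cases hS' with
    | block c h' =>
      rw [add_comm] at hin
      refine two c c fun d hd _ => ?_
      rw [add_comm]
      exact block_column_support h' h ha' ha hin d hd
    | column j h' =>
      ext b
      refine blockParity_eq_zero fun q _ => ?_
      rcases q with ⟨d, m⟩ | d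
      · refine congrFun (eq_zero_of_two_positions rmRow_column_ne_zero rmRow_column_injective
          (w := fun i => (a + a') (.inl (d, i))) (i := i) (j := j) (fun m hmi hmj => ?_) (hin d)) m
        simp only [Pi.add_apply]
        rw [column_support h ha d m hmi, column_support h' ha' d m hmj, add_zero]
      · rw [Pi.add_apply, column_support_bare h ha, column_support_bare h' ha', add_zero]

/-- A vector of even weight on every block is a combination of inner checks if this holds on each
Reed-Muller block. -/
lemma eq_sum_innerCheck {K : Type} [Fintype K] {v : K → Fin 15 → ZMod 2} {x : Qubit49 → ZMod 2}
    (hx : blockParity x = 0)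
    (h : ∀ b, ∃ u : K → ZMod 2, (fun i => x (.inl (b, i))) = ∑ k, u k • v k) :
    ∃ u : {b : Fin 7 // b ∈ B₁} × K → ZMod 2, x = ∑ p, u p • innerCheck p.1 (v p.2) := by
  choose u hu using h
  refine ⟨fun p => u p.1 p.2, ?_⟩
  ext q
  rcases q with ⟨b, i⟩ | b
  · rw [sum_innerCheck_inl]
    simpa [Finset.sum_apply] using congrFun (hu b) i
  · rw [sum_innerCheck_inr (fun p => u p.1 p.2), ← blockParity_bare x, hx]
    rfl

/-- The syndrome of a pattern of phase flips. -/
def xSyn (b : Qubit49 → ZMod 2) : XSyndrome := fun i => xCheck i ⬝ᵥ b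

/-- The syndrome of a pattern of bit flips. -/
def zSyn (a : Qubit49 → ZMod 2) : ZSyndrome := fun j => zCheck j ⬝ᵥ a

lemma rmZRow_self (k : Fin 4) : rmZRow ⟨(k, k), le_refl k⟩ = rmRow k := by
  revert k; decide +kernel

lemma exists_zCheck_span {a a' : Qubit49 → ZMod 2} (ha : IsCorrectableError a)
    (ha' : IsCorrectableError a') (h : xSyn a = xSyn a') :
    ∃ u : ZIndex → ZMod 2, a + a' = ∑ j, u j • zCheck j := by
  have hz : ∀ i, xCheck i ⬝ᵥ (a + a') = 0 := fun i => by
    rw [dotProduct_add, show xCheck i ⬝ᵥ a = xCheck i ⬝ᵥ a' from congrFun h i,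
      CharTwo.add_self_eq_zero]
  have hin : ∀ b k, rmRow k ⬝ᵥ (fun i => (a + a') (.inl (b, i))) = 0 := fun b k => by
    rw [← innerCheck_dotProduct]; exact hz (.inl (b, k))
  have hp := blockParity_eq_zero_of_syndrome ha ha' hin fun k => by
    rw [← outerCheck_dotProduct]; exact hz (.inr k)
  obtain ⟨u, hu⟩ := eq_sum_innerCheck hp fun b => exists_rmZRow_span (hin b) (by
    rw [← blockParity_block, hp]; rfl)
  refine ⟨Sum.elim u 0, ?_⟩
  rw [hu, Fintype.sum_sum_type]
  simp [zCheck]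

lemma exists_xCheck_span {a a' : Qubit49 → ZMod 2} (ha : IsCorrectableError a)
    (ha' : IsCorrectableError a') (h : zSyn a = zSyn a') :
    ∃ u : XIndex → ZMod 2, a + a' = ∑ i, u i • xCheck i := by
  have hz : ∀ j, zCheck j ⬝ᵥ (a + a') = 0 := fun j => by
    rw [dotProduct_add, show zCheck j ⬝ᵥ a = zCheck j ⬝ᵥ a' from congrFun h j,
      CharTwo.add_self_eq_zero]
  have hin : ∀ b p, rmZRow p ⬝ᵥ (fun i => (a + a') (.inl (b, i))) = 0 := fun b p => by
    rw [← innerCheck_dotProduct]; exact hz (.inl (b, p))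
  have hp := blockParity_eq_zero_of_syndrome ha ha'
    (fun b k => by rw [← rmZRow_self]; exact hin b _) fun k => by
      rw [← outerCheck_dotProduct]; exact hz (.inr k)
  obtain ⟨u, hu⟩ := eq_sum_innerCheck hp fun b => exists_rmRow_span (hin b) (by
    rw [← blockParity_block, hp]; rfl)
  refine ⟨Sum.elim u 0, ?_⟩
  rw [hu, Fintype.sum_sum_type]
  simp [xCheck]

/-! ### The recovery operation -/

open Classical in
/-- The decoder: bit flips and phase flips are decoded separately, each to some correctable pattern
with the measured syndrome, if there is one. -/
def decoder49 : Decoder := fun s t =>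
  (if h : ∃ a, IsCorrectableError a ∧ zSyn a = t then h.choose else 0,
    if h : ∃ b, IsCorrectableError b ∧ xSyn b = s then h.choose else 0)

/-- The group generated by the `X`-type generators. -/
def xStab (u : XIndex → ZMod 2) : Op Qubit49 := pauliX (∑ i, u i • xCheck i)

/-- The group generated by the `Z`-type generators. -/
def zStab (u : ZIndex → ZMod 2) : Op Qubit49 := pauliZ (∑ j, u j • zCheck j)

lemma xStab_add (u v : XIndex → ZMod 2) : xStab (u + v) = xStab u * xStab v := by
  simp only [xStab, Pi.add_apply, add_smul, Finset.sum_add_distrib, pauliX_add]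

lemma zStab_add (u v : ZIndex → ZMod 2) : zStab (u + v) = zStab u * zStab v := by
  simp only [zStab, Pi.add_apply, add_smul, Finset.sum_add_distrib, pauliZ_add]

lemma xStab_zero : xStab 0 = 1 := by simp [xStab, pauliX_zero]

lemma zStab_zero : zStab 0 = 1 := by simp [zStab, pauliZ_zero]

lemma pauliX_mul_self {ι : Type} [Fintype ι] [DecidableEq ι] (a : ι → ZMod 2) :
    pauliX a * pauliX a = 1 := by rw [← pauliX_add, vec_add_self, pauliX_zero]

lemma pauliZ_mul_self {ι : Type} [Fintype ι] [DecidableEq ι] (a : ι → ZMod 2) :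
    pauliZ a * pauliZ a = 1 := by rw [← pauliZ_add, vec_add_self, pauliZ_zero]

/-- Error correction is a quantum operation, whatever the decoding table. -/
theorem sum_recovery (D : Decoder) : ∑ s, ∑ t, (recovery D s t)ᴴ * recovery D s t = 1 := by
  have h : ∀ s t, (recovery D s t)ᴴ * recovery D s t = zProj t * xProj s * zProj t := by
    intro s t
    have hx : (xProj s)ᴴ = xProj s := synProj_conjTranspose (fun u => pauliX_conjTranspose _) s
    have hz : (zProj t)ᴴ = zProj t := synProj_conjTranspose (fun u => pauliZ_conjTranspose _) t
    have hxx : xProj s * xProj s = xProj s := synProj_mul_self xStab_add s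
    simp only [recovery, Matrix.conjTranspose_mul, pauliX_conjTranspose, pauliZ_conjTranspose, hx,
      hz, mul_assoc]
    rw [← mul_assoc (pauliX _) (pauliX _), pauliX_mul_self, one_mul,
      ← mul_assoc (pauliZ _) (pauliZ _), pauliZ_mul_self, one_mul, ← mul_assoc (xProj s), hxx]
  simp only [h]
  rw [Finset.sum_comm]
  have h2 : ∀ t, ∑ s, zProj t * xProj s * zProj t = zProj t := fun t => by
    rw [← Finset.sum_mul, ← Finset.mul_sum, show ∑ s, xProj s = 1 from sum_synProj xStab_zero,
      mul_one]
    exact synProj_mul_self zStab_add t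
  simp only [h2]
  exact sum_synProj zStab_zero

lemma zProj_mul_pauliX (t : ZSyndrome) (a : Qubit49 → ZMod 2) :
    zProj t * pauliX a = pauliX a * zProj (t + zSyn a) := by
  refine synProj_mul_comm (fun u => ?_) t
  change pauliZ _ * _ = _ • (_ * pauliZ _)
  rw [pauliZ_mul_pauliX, sum_dotProduct]
  simp only [smul_dotProduct, smul_eq_mul]
  rw [dotProduct_comm (zSyn a)]
  rfl

lemma xProj_mul_pauliZ (s : XSyndrome) (b : Qubit49 → ZMod 2) :
    xProj s * pauliZ b = pauliZ b * xProj (s + xSyn b) := by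
  refine synProj_mul_comm (fun u => ?_) s
  change pauliX _ * _ = _ • (_ * pauliX _)
  rw [pauliX_mul_pauliZ, dotProduct_comm, sum_dotProduct]
  simp only [smul_dotProduct, smul_eq_mul]
  rw [dotProduct_comm (xSyn b)]
  rfl

lemma xProj_mul_pauliX (s : XSyndrome) (a : Qubit49 → ZMod 2) :
    xProj s * pauliX a = pauliX a * xProj s := by
  have := synProj_mul_comm (U := xStab) (Q := pauliX a) (e := 0) (fun u => by
    rw [zero_dotProduct, bitSign_zero, one_smul, show xStab u = pauliX _ from rfl,
      ← pauliX_add, ← pauliX_add, add_comm]) s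
  rwa [add_zero] at this

lemma zProj_mul_pauliZ (t : ZSyndrome) (b : Qubit49 → ZMod 2) :
    zProj t * pauliZ b = pauliZ b * zProj t := by
  have := synProj_mul_comm (U := zStab) (Q := pauliZ b) (e := 0) (fun u => by
    rw [zero_dotProduct, bitSign_zero, one_smul, show zStab u = pauliZ _ from rfl,
      ← pauliZ_add, ← pauliZ_add, add_comm]) t
  rwa [add_zero] at this

/-- The measurement maps a Pauli error on a codeword to itself if the outcome is its syndrome, and
to zero otherwise. -/
lemma proj_mul_pauli_mul_encoder49 (s : XSyndrome) (t : ZSyndrome) (a b : Qubit49 → ZMod 2) :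
    xProj s * zProj t * (pauliX a * pauliZ b) * encoder49 =
      if s = xSyn b ∧ t = zSyn a then pauliX a * pauliZ b * encoder49 else 0 := by
  have h0 : ∀ {P : Type} (v w : P → ZMod 2), v + w = 0 ↔ v = w := fun v w => by
    rw [eq_comm, ← zero_add w, ← vec_eq_add_iff (x := v), zero_add]
  have hz : ∀ t t', zProj (t + t') * encoder49 = if t = t' then encoder49 else 0 := fun t t' =>
    (synProj_mul_of_fixed pauliZ_span_mul_encoder49 _).trans (if_congr (h0 t t') rfl rfl)
  have hx : ∀ s s', xProj (s + s') * encoder49 = if s = s' then encoder49 else 0 := fun s s' =>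
    (synProj_mul_of_fixed pauliX_span_mul_encoder49 _).trans (if_congr (h0 s s') rfl rfl)
  rw [← mul_assoc, mul_assoc (xProj s), zProj_mul_pauliX, ← mul_assoc, xProj_mul_pauliX,
    mul_assoc (pauliX a * xProj s), zProj_mul_pauliZ, ← mul_assoc (pauliX a * xProj s),
    mul_assoc (pauliX a), xProj_mul_pauliZ, Matrix.mul_assoc, hz]
  split_ifs with h1 h2 h2
  · rw [Matrix.mul_assoc, Matrix.mul_assoc, hx, if_pos h2.1, Matrix.mul_assoc]
  · rw [Matrix.mul_assoc, Matrix.mul_assoc, hx, if_neg fun h => h2 ⟨h, h1⟩, Matrix.mul_zero,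
      Matrix.mul_zero]
  · exact absurd h2.2 h1
  · rw [Matrix.mul_zero]

/-- Correctable Pauli errors are corrected. -/
lemma recovery_mul_pauli_mul_encoder49 {a b : Qubit49 → ZMod 2} (ha : IsCorrectableError a)
    (hb : IsCorrectableError b) (s : XSyndrome) (t : ZSyndrome) :
    ∃ c : ℂ, recovery decoder49 s t * (pauliX a * pauliZ b) * encoder49 = c • encoder49 := by
  have e : recovery decoder49 s t * (pauliX a * pauliZ b) * encoder49 =
      pauliX (decoder49 s t).1 * pauliZ (decoder49 s t).2 *
        (xProj s * zProj t * (pauliX a * pauliZ b) * encoder49) := by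
    simp only [recovery, Matrix.mul_assoc]
  rw [e, proj_mul_pauli_mul_encoder49]
  split_ifs with h
  · obtain ⟨rfl, rfl⟩ := h
    have hex : ∃ a', IsCorrectableError a' ∧ zSyn a' = zSyn a := ⟨a, ha, rfl⟩
    have hez : ∃ b', IsCorrectableError b' ∧ xSyn b' = xSyn b := ⟨b, hb, rfl⟩
    have hD : decoder49 (xSyn b) (zSyn a) = (hex.choose, hez.choose) := by
      simp only [decoder49, dif_pos hex, dif_pos hez]
    obtain ⟨u, hu⟩ := exists_xCheck_span hex.choose_spec.1 ha hex.choose_spec.2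
    obtain ⟨v, hv⟩ := exists_zCheck_span hez.choose_spec.1 hb hez.choose_spec.2
    rw [hD]
    generalize hex.choose = a' at hu ⊢
    generalize hez.choose = b' at hv ⊢
    refine ⟨bitSign (b' ⬝ᵥ a), ?_⟩
    rw [← Matrix.mul_assoc, ← Matrix.mul_assoc, Matrix.mul_assoc (pauliX a'), pauliZ_mul_pauliX,
      Matrix.mul_smul, ← Matrix.mul_assoc (pauliX a'), ← pauliX_add, Matrix.smul_mul,
      Matrix.mul_assoc (pauliX _), ← pauliZ_add, hu, hv, Matrix.smul_mul, Matrix.mul_assoc,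
      pauliZ_span_mul_encoder49, pauliX_span_mul_encoder49]
  · exact ⟨0, by rw [Matrix.mul_zero, zero_smul]⟩

/-- A combination of Pauli errors is undone, up to a scalar, if each of them is. -/
lemma exists_smul_eq_of_mem_pauliSpan {ι m : Type} [Fintype ι] [DecidableEq ι] {S : Set ι}
    {R : Op ι} {V : Matrix (ι → ZMod 2) m ℂ}
    (h : ∀ a b : ι → ZMod 2, (∀ q ∉ S, a q = 0) → (∀ q ∉ S, b q = 0) →
      ∃ c : ℂ, R * (pauliX a * pauliZ b) * V = c • V) {E : Op ι} (hE : E ∈ pauliSpan S) :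
    ∃ c : ℂ, R * E * V = c • V := by
  induction hE using Submodule.span_induction with
  | mem E hE =>
    obtain ⟨a, b, ha, hb, rfl⟩ := hE
    exact h a b ha hb
  | zero => exact ⟨0, by simp⟩
  | add E F _ _ hE hF =>
    obtain ⟨c, hc⟩ := hE
    obtain ⟨d, hd⟩ := hF
    exact ⟨c + d, by rw [mul_add, Matrix.add_mul, hc, hd, add_smul]⟩
  | smul z E _ hE =>
    obtain ⟨c, hc⟩ := hE
    exact ⟨z * c, by rw [Matrix.mul_smul, Matrix.smul_mul, hc, smul_smul]⟩

theorem decoder49_corrects : CorrectsSingleErrors decoder49 := by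
  intro q E hE s t
  have hS : Correctable {q} := .block q.outer (by rintro _ rfl; rfl)
  exact exists_smul_eq_of_mem_pauliSpan (fun a b ha hb =>
    recovery_mul_pauli_mul_encoder49 ⟨_, hS, ha⟩ ⟨_, hS, hb⟩ s t) hE.mem_pauliSpan

/-! ### Several code blocks -/

/-- The tensor product of a family of operators, where the rows and columns are indexed by
families. -/
def tensorFamily {κ α β : Type} [Fintype κ] (M : κ → Matrix α β ℂ) : Matrix (κ → α) (κ → β) ℂ :=
  Matrix.of fun x y => ∏ a, M a (x a) (y a)

lemma tensorFamily_mul {κ α β γ : Type} [Fintype κ] [DecidableEq κ] [Fintype β]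
    (M : κ → Matrix α β ℂ) (N : κ → Matrix β γ ℂ) :
    tensorFamily M * tensorFamily N = tensorFamily fun a => M a * N a := by
  ext x y
  simp only [tensorFamily, Matrix.mul_apply, Matrix.of_apply, Finset.prod_univ_sum,
    Fintype.piFinset_univ, Finset.prod_mul_distrib]

section Blocks
variable {κ : Type} [Fintype κ]

lemma blockEncoder_eq : blockEncoder κ =
    (tensorFamily fun _ : κ => encoder49).submatrix (Equiv.curry κ Qubit49 (ZMod 2)) id := rfl

lemma blockRecovery_eq (D : Decoder) (s : κ → XSyndrome) (t : κ → ZSyndrome) :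
    blockRecovery D s t = (tensorFamily fun a => recovery D (s a) (t a)).submatrix
      (Equiv.curry κ Qubit49 (ZMod 2)) (Equiv.curry κ Qubit49 (ZMod 2)) := rfl

variable [DecidableEq κ]

lemma pauli_eq_tensorFamily (a b : κ × Qubit49 → ZMod 2) : pauliX a * pauliZ b =
    (tensorFamily fun k => pauliX (fun q => a (k, q)) * pauliZ fun q => b (k, q)).submatrix
      (Equiv.curry κ Qubit49 (ZMod 2)) (Equiv.curry κ Qubit49 (ZMod 2)) := by
  ext x y
  rw [mul_pauliZ_apply]
  simp only [Matrix.submatrix_apply, tensorFamily, Matrix.of_apply, mul_pauliZ_apply,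
    Finset.prod_mul_distrib, pauliX]
  congr 1
  · rw [Finset.prod_boole]
    refine boole_congr ?_
    simp only [Finset.mem_univ, true_implies, funext_iff, Prod.forall]
    rfl
  · rw [← bitSign_sum, dotProduct, Fintype.sum_prod_type]
    rfl

lemma blockRecovery_mul_pauli {a b : κ × Qubit49 → ZMod 2}
    (ha : ∀ k, IsCorrectableError fun q => a (k, q))
    (hb : ∀ k, IsCorrectableError fun q => b (k, q)) (s : κ → XSyndrome) (t : κ → ZSyndrome) :
    ∃ c : ℂ, blockRecovery decoder49 s t * (pauliX a * pauliZ b) * blockEncoder κ =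
      c • blockEncoder κ := by
  choose c hc using fun k => recovery_mul_pauli_mul_encoder49 (ha k) (hb k) (s k) (t k)
  refine ⟨∏ k, c k, ?_⟩
  rw [blockRecovery_eq, pauli_eq_tensorFamily, blockEncoder_eq, Matrix.submatrix_mul_equiv,
    Matrix.submatrix_mul_equiv, tensorFamily_mul, tensorFamily_mul]
  simp only [hc]
  ext x l
  simp [tensorFamily, Finset.prod_mul_distrib]

/-- Fault tolerance of a circuit whose gates act within the fibres of a labelling `L` such that each
code block meets each fibre in a correctable set. -/
theorem FaultTolerant.of_labelling {β : Type} (L : κ × Qubit49 → β) {G : Op κ}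
    {C : List (Gate (κ × Qubit49))} (hL : ∀ b k, Correctable {q | L (k, q) = b})
    (hC : ∀ g ∈ C, ∃ b, ∀ p ∈ g.support, L p = b)
    (hG : circuitOp C * blockEncoder κ = blockEncoder κ * G) : FaultTolerant decoder49 G C := by
  refine ⟨hG, fun F hF s t => ?_⟩
  obtain ⟨c, E, hE, rfl⟩ := hF.exists_error hC
  suffices h : ∃ c : ℂ, blockRecovery decoder49 s t * E * blockEncoder κ = c • blockEncoder κ by
    obtain ⟨c, hc⟩ := h
    refine ⟨c, ?_⟩
    rw [← mul_assoc, Matrix.mul_assoc, hG, ← Matrix.mul_assoc, hc, Matrix.smul_mul]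
  exact exists_smul_eq_of_mem_pauliSpan (fun a b ha hb => blockRecovery_mul_pauli
    (fun k => ⟨_, hL c k, fun q hq => ha _ hq⟩) (fun k => ⟨_, hL c k, fun q hq => hb _ hq⟩) s t) hE

theorem IsTransversal.faultTolerant {G : Op κ} {C : List (Gate (κ × Qubit49))}
    (hC : IsTransversal C) (hG : circuitOp C * blockEncoder κ = blockEncoder κ * G) :
    FaultTolerant decoder49 G C :=
  .of_labelling (fun p => p.2) (fun q _ => .block q.outer (by rintro _ rfl; rfl)) hC hG

theorem IsSteaneTransversal.faultTolerant {G : Op κ} {C : List (Gate (κ × Qubit49))}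
    (hC : IsSteaneTransversal C) (hG : circuitOp C * blockEncoder κ = blockEncoder κ * G) :
    FaultTolerant decoder49 G C :=
  .of_labelling (fun p => p.2.outer) (fun b _ => .block b fun _ h => h) hC hG

theorem IsRMTransversal.faultTolerant {G : Op κ} {C : List (Gate (κ × Qubit49))}
    (hC : IsRMTransversal C) (hG : circuitOp C * blockEncoder κ = blockEncoder κ * G) :
    FaultTolerant decoder49 G C := by
  refine .of_labelling (fun p => Sum.map Prod.snd id p.2) (fun c _ => ?_) (fun g hg => ?_) hG
  · rcases c with i | b
    · refine .column i fun q hq => ?_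
      rcases q with ⟨b, j⟩ | b
      · exact ⟨b, by rw [show j = i by simpa using hq]⟩
      · simp at hq
    · refine .block b.1 fun q hq => ?_
      rcases q with p | b'
      · simp at hq
      · rw [show b' = b by simpa using hq]; rfl
  · obtain ⟨i, hi⟩ := hC g hg
    refine ⟨.inl i, fun p hp => ?_⟩
    obtain ⟨b, hb⟩ := hi p hp
    simp [hb]

end Blocks

/-! ### The phase gates -/

section Diagonal
variable {κ : Type} [Fintype κ] [DecidableEq κ]

/-- A diagonal circuit implements a diagonal gate if the phases agree on the basis states that occur
in codewords. -/
lemma diagonal_mul_blockEncoder {C : List (Gate (κ × Qubit49))} {G : Op κ}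
    {d : (κ × Qubit49 → ZMod 2) → ℂ} {g : (κ → ZMod 2) → ℂ} (hC : circuitOp C = Matrix.diagonal d)
    (hG : G = Matrix.diagonal g)
    (h : ∀ x l, (∀ a, encoder49 (fun q => x (a, q)) (l a) ≠ 0) → d x = g l) :
    circuitOp C * blockEncoder κ = blockEncoder κ * G := by
  rw [hC, hG]
  ext x l
  rw [Matrix.diagonal_mul, Matrix.mul_diagonal]
  by_cases h0 : blockEncoder κ x l = 0
  · rw [h0, mul_zero, zero_mul]
  · rw [h x l fun a => Finset.prod_ne_zero_iff.mp h0 a (Finset.mem_univ a), mul_comm]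

end Diagonal

/-- Words of the Reed-Muller code in the coset of `l` have weight `0`, `8` or `15`, `7`. -/
lemma rmWord_weight : ∀ (u : Fin 4 → ZMod 2) (l : ZMod 2),
    (∑ i, (∑ k, u k * rmRow k i + l).val) % 8 = (7 * l.val) % 8 := by decide +kernel

/-- Words of the Steane code in the coset of `l` have weight `0`, `4` or `7`, `3`. -/
lemma steaneWord_weight : ∀ (v : Fin 3 → ZMod 2) (l : ZMod 2),
    (∑ b, (∑ k, v k * steaneRow k b + l).val) % 4 = (3 * l.val) % 4 := by decide +kernel

lemma prod_rmWord {z : ℂ} (hz : z ^ 8 = 1) (u : Fin 4 → ZMod 2) (l : ZMod 2) :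
    ∏ i, z ^ (∑ k, u k * rmRow k i + l).val = (z ^ 7) ^ l.val := by
  rw [Finset.prod_pow_eq_pow_sum, ← pow_mul, pow_eq_pow_mod _ hz, rmWord_weight,
    ← pow_eq_pow_mod _ hz]

lemma prod_steaneWord {z : ℂ} (hz : z ^ 4 = 1) (v : Fin 3 → ZMod 2) (l : ZMod 2) :
    ∏ b, z ^ (∑ k, v k * steaneRow k b + l).val = (z ^ 3) ^ l.val := by
  rw [Finset.prod_pow_eq_pow_sum, ← pow_mul, pow_eq_pow_mod _ hz, steaneWord_weight,
    ← pow_eq_pow_mod _ hz]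

lemma prod_B₁_mul_prod_bare (f : Fin 7 → ℂ) :
    (∏ b : {b : Fin 7 // b ∈ B₁}, f b) * ∏ b : {b : Fin 7 // b ∉ B₁}, f b = ∏ b, f b := by
  convert Fintype.prod_subtype_mul_prod_subtype (· ∈ B₁) f

/-- The transversal circuit for `S`: `S†` on the bare qubits, and `S` on the qubits of the
Reed-Muller blocks, where it acts as the logical `S†` of the block. -/
def sCircuit : List (Gate (Fin 1 × Qubit49)) :=
  Finset.univ.toList.flatMap fun q : Qubit49 =>
    [q.elim (fun p => Gate.s (0, .inl p)) fun b => Gate.sdg (0, .inr b)]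

lemma sCircuit_isTransversal : IsTransversal sCircuit := by
  intro g hg
  obtain ⟨q, -, hq⟩ := List.mem_flatMap.mp hg
  rw [List.mem_singleton] at hq
  refine ⟨q, fun p hp => ?_⟩
  subst hq
  rcases q with q | q <;> · rw [show p = _ from hp]

lemma sCircuit_op :
    circuitOp sCircuit * blockEncoder (Fin 1) = blockEncoder (Fin 1) * (Gate.s (0 : Fin 1)).op := by
  refine diagonal_mul_blockEncoder (circuitOp_flatMap_univ _
    (fun q x => (q.elim (fun _ => Complex.I) fun _ => -Complex.I) ^ (x (0, q)).val) fun q => ?_)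
    (phaseGate_eq_diagonal 0 Complex.I) fun x l h => ?_
  · rw [circuitOp_singleton]
    rcases q with q | q
    · exact phaseGate_eq_diagonal _ _
    · exact phaseGate_eq_diagonal _ _
  · obtain ⟨u, v, h1, h2⟩ := exists_of_encoder49_ne_zero (h 0)
    have hI : ((-Complex.I) ^ 4 : ℂ) = 1 := by rw [neg_pow, Complex.I_pow_four]; norm_num
    have hI8 : (Complex.I ^ 8 : ℂ) = 1 := by
      rw [show 8 = 4 * 2 from rfl, pow_mul, Complex.I_pow_four, one_pow]
    have hI7 : (Complex.I ^ 7 : ℂ) = -Complex.I := by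
      rw [show 7 = 4 + 3 from rfl, pow_add, Complex.I_pow_four, one_mul, Complex.I_pow_three]
    have hI3 : ((-Complex.I) ^ 3 : ℂ) = Complex.I := by
      rw [neg_pow, Complex.I_pow_three]; norm_num
    rw [Fintype.prod_sum_type, Fintype.prod_prod_type]
    simp only [Sum.elim_inl, Sum.elim_inr, h1, h2]
    simp only [prod_rmWord hI8, hI7]
    rw [prod_B₁_mul_prod_bare fun b => (-Complex.I) ^ (∑ k, v k * steaneRow k b + l 0).val,
      prod_steaneWord hI, hI3]

/-! ### Phase gates on the Reed-Muller blocks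

The logical operator `Z₁Z₂Z₇` of the Steane code lives on the Reed-Muller blocks. So the sum of the
three blocks is a Reed-Muller word that encodes the logical qubit, and diagonal gates are applied to
it. -/

/-- Block `0` of `B₁`. -/
def rm0 : {b : Fin 7 // b ∈ B₁} := ⟨0, by decide⟩

/-- Block `1` of `B₁`. -/
def rm1 : {b : Fin 7 // b ∈ B₁} := ⟨1, by decide⟩

/-- Block `6` of `B₁`. -/
def rm6 : {b : Fin 7 // b ∈ B₁} := ⟨6, by decide⟩

lemma sum_B₁ (f : {b : Fin 7 // b ∈ B₁} → ZMod 2) : ∑ b, f b = f rm0 + f rm1 + f rm6 := by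
  rw [show (Finset.univ : Finset {b : Fin 7 // b ∈ B₁}) = {rm0, rm1, rm6} by decide,
    Finset.sum_insert (by decide), Finset.sum_insert (by decide), Finset.sum_singleton, add_assoc]

lemma sum_B₁_steaneRow : ∀ k, ∑ b : {b : Fin 7 // b ∈ B₁}, steaneRow k b.1 = 0 := by
  decide +kernel

/-- In a codeword the sum of the three Reed-Muller blocks is a Reed-Muller word that encodes the
logical qubit. -/
lemma exists_rmWord_of_encoder49_ne_zero {x : Qubit49 → ZMod 2} {l : ZMod 2}
    (h : encoder49 x l ≠ 0) :
    ∃ u : Fin 4 → ZMod 2, ∀ i,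
      ∑ b : {b : Fin 7 // b ∈ B₁}, x (.inl (b, i)) = ∑ k, u k * rmRow k i + l := by
  obtain ⟨u, v, h1, -⟩ := exists_of_encoder49_ne_zero h
  refine ⟨fun k => ∑ b, u b k, fun i => ?_⟩
  simp only [h1, Finset.sum_add_distrib]
  have hl : ∑ b : {b : Fin 7 // b ∈ B₁}, l = l := by
    rw [sum_B₁, CharTwo.add_self_eq_zero, zero_add]
  have hv : ∑ b : {b : Fin 7 // b ∈ B₁}, ∑ k, v k * steaneRow k b.1 = 0 := by
    rw [Finset.sum_comm]
    simp only [← Finset.mul_sum, sum_B₁_steaneRow, mul_zero, Finset.sum_const_zero]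
  rw [hl, hv, zero_add, Finset.sum_comm]
  simp only [Finset.sum_mul]

lemma cnot_conj_diagonal {ι : Type} [Fintype ι] [DecidableEq ι] {i j : ι} (hij : i ≠ j)
    (d : (ι → ZMod 2) → ℂ) :
    (Gate.cnot i j hij).op * Matrix.diagonal d * (Gate.cnot i j hij).op =
      Matrix.diagonal fun x => d (Function.update x j (x j + x i)) := by
  have h : (Gate.cnot i j hij).op * Matrix.diagonal d =
      Matrix.diagonal (fun x => d (Function.update x j (x j + x i))) * (Gate.cnot i j hij).op := by
    ext x y
    rw [Matrix.mul_diagonal, Matrix.diagonal_mul]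
    simp only [Gate.op, Matrix.of_apply]
    split_ifs with hxy
    · rw [← (update_add_involutive hij).mp hxy, one_mul, mul_one]
    · simp
  rw [h, mul_assoc, cnot_mul_self, mul_one]

/-- The qubit at position `i` of a Reed-Muller block of the code block `a`. -/
abbrev rmQubit {κ : Type} (a : κ) (b : {b : Fin 7 // b ∈ B₁}) (i : Fin 15) : κ × Qubit49 :=
  (a, .inl (b, i))

lemma rmQubit_ne {κ : Type} (a : κ) {b c : {b : Fin 7 // b ∈ B₁}} (h : b ≠ c) (i : Fin 15) :
    rmQubit a b i ≠ rmQubit a c i := by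
  simpa [rmQubit] using h

/-- The part of the circuit for `T` at position `i`: `T†` on the parity of the three blocks. -/
def tStep (i : Fin 15) : List (Gate (Fin 1 × Qubit49)) :=
  [.cnot (rmQubit 0 rm0 i) (rmQubit 0 rm6 i) (rmQubit_ne 0 (by decide) i),
    .cnot (rmQubit 0 rm1 i) (rmQubit 0 rm6 i) (rmQubit_ne 0 (by decide) i),
    .tdg (rmQubit 0 rm6 i),
    .cnot (rmQubit 0 rm1 i) (rmQubit 0 rm6 i) (rmQubit_ne 0 (by decide) i),
    .cnot (rmQubit 0 rm0 i) (rmQubit 0 rm6 i) (rmQubit_ne 0 (by decide) i)]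

/-- The circuit for `T`. -/
def tCircuit : List (Gate (Fin 1 × Qubit49)) := Finset.univ.toList.flatMap tStep

lemma tCircuit_isRMTransversal : IsRMTransversal tCircuit := by
  intro g hg
  obtain ⟨i, -, hi⟩ := List.mem_flatMap.mp hg
  refine ⟨i, fun p hp => ?_⟩
  simp only [tStep, List.mem_cons, List.not_mem_nil, or_false] at hi
  rcases hi with rfl | rfl | rfl | rfl | rfl <;>
    simp only [Gate.support, Set.mem_insert_iff, Set.mem_singleton_iff] at hp
  · rcases hp with rfl | rfl <;> exact ⟨_, rfl⟩
  · rcases hp with rfl | rfl <;> exact ⟨_, rfl⟩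
  · subst hp; exact ⟨_, rfl⟩
  · rcases hp with rfl | rfl <;> exact ⟨_, rfl⟩
  · rcases hp with rfl | rfl <;> exact ⟨_, rfl⟩

lemma circuitOp_tStep (i : Fin 15) : circuitOp (tStep i) = Matrix.diagonal fun x =>
    Complex.exp (-(Complex.I * (Real.pi : ℂ) / 4)) ^ (∑ b, x (rmQubit 0 b i)).val := by
  have h : circuitOp (tStep i) =
      (Gate.cnot (rmQubit 0 rm0 i) (rmQubit 0 rm6 i) (rmQubit_ne (0 : Fin 1) (by decide) i)).op *
        ((Gate.cnot (rmQubit 0 rm1 i) (rmQubit 0 rm6 i) (rmQubit_ne 0 (by decide) i)).op *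
          (Gate.tdg (rmQubit 0 rm6 i)).op *
          (Gate.cnot (rmQubit 0 rm1 i) (rmQubit 0 rm6 i) (rmQubit_ne 0 (by decide) i)).op) *
        (Gate.cnot (rmQubit 0 rm0 i) (rmQubit 0 rm6 i) (rmQubit_ne 0 (by decide) i)).op := by
    simp only [tStep, circuitOp, one_mul, mul_assoc]
  rw [h, show (Gate.tdg (rmQubit (0 : Fin 1) rm6 i)).op = _ from phaseGate_eq_diagonal _ _,
    cnot_conj_diagonal, cnot_conj_diagonal]
  congr 1
  ext x
  rw [Function.update_self, Function.update_self,
    Function.update_of_ne (rmQubit_ne 0 (by decide) i), sum_B₁]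
  congr 2
  ring

lemma tCircuit_op :
    circuitOp tCircuit * blockEncoder (Fin 1) = blockEncoder (Fin 1) * (Gate.t (0 : Fin 1)).op := by
  refine diagonal_mul_blockEncoder (circuitOp_flatMap_univ _ _ circuitOp_tStep)
    (phaseGate_eq_diagonal 0 _) fun x l h => ?_
  obtain ⟨u, hu⟩ := exists_rmWord_of_encoder49_ne_zero (h 0)
  have h8 : Complex.exp (-(Complex.I * (Real.pi : ℂ) / 4)) ^ 8 = 1 := by
    rw [← Complex.exp_nat_mul, Complex.exp_eq_one_iff]
    exact ⟨-1, by push_cast; ring⟩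
  have h7 : Complex.exp (-(Complex.I * (Real.pi : ℂ) / 4)) ^ 7 =
      Complex.exp (Complex.I * (Real.pi : ℂ) / 4) := by
    rw [← mul_left_inj' (Complex.exp_ne_zero (-(Complex.I * (Real.pi : ℂ) / 4))), ← pow_succ, h8,
      ← Complex.exp_add, add_neg_cancel, Complex.exp_zero]
  simp only [rmQubit, hu]
  rw [prod_rmWord h8, h7]

/-- The circuit for `CCZ`: at each position, `CCZ` on all triples of qubits of Reed-Muller blocks,
one from each code block; this is `CCZ` on the parities of the blocks. -/
def cczCircuit : List (Gate (Fin 3 × Qubit49)) :=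
  Finset.univ.toList.flatMap fun p :
    Fin 15 × {b : Fin 7 // b ∈ B₁} × {b : Fin 7 // b ∈ B₁} × {b : Fin 7 // b ∈ B₁} =>
    [.ccz (rmQubit 0 p.2.1 p.1) (rmQubit 1 p.2.2.1 p.1) (rmQubit 2 p.2.2.2 p.1)
      (fun h => absurd (congrArg Prod.fst h) (by decide : (0 : Fin 3) ≠ 1))
      (fun h => absurd (congrArg Prod.fst h) (by decide : (0 : Fin 3) ≠ 2))
      (fun h => absurd (congrArg Prod.fst h) (by decide : (1 : Fin 3) ≠ 2))]

lemma cczCircuit_isRMTransversal : IsRMTransversal cczCircuit := by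
  intro g hg
  obtain ⟨i, -, hi⟩ := List.mem_flatMap.mp hg
  refine ⟨i.1, fun p hp => ?_⟩
  rw [List.mem_singleton] at hi
  subst hi
  simp only [Gate.support, Set.mem_insert_iff, Set.mem_singleton_iff] at hp
  rcases hp with rfl | rfl | rfl <;> exact ⟨_, rfl⟩

/-- The constant word followed by the four Reed-Muller rows. -/
def rmPoly : Fin 5 → Fin 15 → ZMod 2 := Fin.cons (fun _ => 1) rmRow

/-- A product of three polynomials of degree at most one on `(ℤ/2)^4` has degree at most three, so
its values sum to zero; hence the sum over the nonzero points is the value at `0`. -/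
lemma sum_rmPoly_mul : ∀ j k m : Fin 5, ∑ i, rmPoly j i * rmPoly k i * rmPoly m i =
    if j = 0 ∧ k = 0 ∧ m = 0 then 1 else 0 := by decide +kernel

lemma rmWord_eq_sum_rmPoly (u : Fin 4 → ZMod 2) (l : ZMod 2) (i : Fin 15) :
    ∑ k, u k * rmRow k i + l =
      ∑ j, (Fin.cons l u : Fin 5 → ZMod 2) j * rmPoly j i := by
  rw [Fin.sum_univ_succ (n := 4), add_comm]
  simp [rmPoly]

lemma sum_rmWord_mul (u u' u'' : Fin 4 → ZMod 2) (l l' l'' : ZMod 2) :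
    ∑ i, (∑ k, u k * rmRow k i + l) * (∑ k, u' k * rmRow k i + l') *
      (∑ k, u'' k * rmRow k i + l'') = l * l' * l'' := by
  simp only [rmWord_eq_sum_rmPoly]
  generalize hc : (Fin.cons l u : Fin 5 → ZMod 2) = c
  generalize hc' : (Fin.cons l' u' : Fin 5 → ZMod 2) = c'
  generalize hc'' : (Fin.cons l'' u'' : Fin 5 → ZMod 2) = c''
  calc ∑ i, (∑ j, c j * rmPoly j i) * (∑ j, c' j * rmPoly j i) * (∑ j, c'' j * rmPoly j i)
      = ∑ i, ∑ j, ∑ k, ∑ m, c j * c' k * c'' m * (rmPoly j i * rmPoly k i * rmPoly m i) := by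
        refine Finset.sum_congr rfl fun i _ => ?_
        rw [Finset.sum_mul_sum, Finset.sum_mul]
        refine Finset.sum_congr rfl fun j _ => ?_
        rw [Finset.sum_mul]
        refine Finset.sum_congr rfl fun k _ => ?_
        rw [Finset.mul_sum]
        exact Finset.sum_congr rfl fun m _ => by ring
    _ = ∑ j, ∑ k, ∑ m, c j * c' k * c'' m * ∑ i, rmPoly j i * rmPoly k i * rmPoly m i := by
        rw [Finset.sum_comm]
        refine Finset.sum_congr rfl fun j _ => ?_
        rw [Finset.sum_comm]
        refine Finset.sum_congr rfl fun k _ => ?_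
        rw [Finset.sum_comm]
        simp only [Finset.mul_sum]
    _ = c 0 * c' 0 * c'' 0 := by
        simp only [sum_rmPoly_mul, ite_and, mul_ite, mul_one, mul_zero]
        simp
    _ = l * l' * l'' := by rw [← hc, ← hc', ← hc'']; rfl

lemma cczCircuit_op : circuitOp cczCircuit * blockEncoder (Fin 3) = blockEncoder (Fin 3) *
    (Gate.ccz (0 : Fin 3) 1 2 (by decide) (by decide) (by decide)).op := by
  refine diagonal_mul_blockEncoder (circuitOp_flatMap_univ _
    (fun p x => bitSign (x (rmQubit 0 p.2.1 p.1) * x (rmQubit 1 p.2.2.1 p.1) *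
      x (rmQubit 2 p.2.2.2 p.1))) fun p => ?_)
    (ccz_eq_diagonal 0 1 2 _ _ _) fun x l h => ?_
  · rw [circuitOp_singleton, ccz_eq_diagonal]
  · obtain ⟨u, hu⟩ := exists_rmWord_of_encoder49_ne_zero (h 0)
    obtain ⟨u', hu'⟩ := exists_rmWord_of_encoder49_ne_zero (h 1)
    obtain ⟨u'', hu''⟩ := exists_rmWord_of_encoder49_ne_zero (h 2)
    rw [← sum_rmWord_mul u u' u'', ← bitSign_sum, Fintype.sum_prod_type]
    refine congrArg bitSign (Finset.sum_congr rfl fun i _ => ?_)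
    rw [← hu, ← hu', ← hu'', Finset.sum_mul_sum, Finset.sum_mul, Fintype.sum_prod_type]
    refine Finset.sum_congr rfl fun b _ => ?_
    rw [Fintype.sum_prod_type, Finset.sum_mul]
    refine Finset.sum_congr rfl fun b' _ => ?_
    rw [Finset.mul_sum]

/-! ### The controlled-NOT gate -/

/-- The transversal circuit for `CNOT`. -/
def cnotCircuit : List (Gate (Fin 2 × Qubit49)) :=
  (Finset.univ : Finset Qubit49).toList.map fun q => .cnot (0, q) (1, q) (by simp)

lemma cnotCircuit_isTransversal : IsTransversal cnotCircuit := by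
  intro g hg
  obtain ⟨q, -, rfl⟩ := List.mem_map.mp hg
  refine ⟨q, fun p hp => ?_⟩
  simp only [Gate.support, Set.mem_insert_iff, Set.mem_singleton_iff] at hp
  rcases hp with rfl | rfl <;> rfl

lemma circuitOp_cnots_mul_apply {Q m : Type} [Fintype Q] [DecidableEq Q] (L : List Q) (hL : L.Nodup)
    (M : Matrix (Fin 2 × Q → ZMod 2) m ℂ) (x : Fin 2 × Q → ZMod 2) (y : m) :
    (circuitOp (L.map fun q => Gate.cnot ((0 : Fin 2), q) (1, q) (by simp)) * M) x y =
      M (fun p => if p.1 = 1 ∧ p.2 ∈ L then x p + x (0, p.2) else x p) y := by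
  induction L generalizing M x with
  | nil => simp [circuitOp]
  | cons q L ih =>
    rw [List.nodup_cons] at hL
    rw [List.map_cons, circuitOp, Matrix.mul_assoc, ih hL.2, cnot_mul_apply]
    congr 1
    ext ⟨a, q'⟩
    by_cases hq : q' = q
    · subst hq
      by_cases ha : a = 1
      · subst ha; simp [hL.1]
      · simp [ha]
    · simp [hq]

/-- Adding a codeword in the coset of `l` translates the code. -/
lemma encoder49_add {x x' : Qubit49 → ZMod 2} {l : ZMod 2} (h : encoder49 x l ≠ 0) (l' : ZMod 2) :
    encoder49 (x' + x) l' = encoder49 x' (l' + l) := by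
  rw [encoder49_eq_cssEncoder] at h ⊢
  obtain ⟨u, rfl⟩ := exists_of_cssEncoder_ne_zero h
  rw [← add_assoc, cssEncoder_add_const, cssEncoder_add_span]

lemma blockEncoder_two (x : Fin 2 × Qubit49 → ZMod 2) (l : Fin 2 → ZMod 2) :
    blockEncoder (Fin 2) x l =
      encoder49 (fun q => x (0, q)) (l 0) * encoder49 (fun q => x (1, q)) (l 1) :=
  Fin.prod_univ_two fun a => encoder49 (fun q => x (a, q)) (l a)

lemma cnotCircuit_op : circuitOp cnotCircuit * blockEncoder (Fin 2) = blockEncoder (Fin 2) *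
    (Gate.cnot (0 : Fin 2) 1 (by decide)).op := by
  ext x l
  have key : ∀ x' : Fin 2 × Qubit49 → ZMod 2, (∀ q, x' (0, q) = x (0, q)) →
      (∀ q, x' (1, q) = x (1, q) + x (0, q)) → blockEncoder (Fin 2) x' l =
        blockEncoder (Fin 2) x (Function.update l 1 (l 1 + l 0)) := by
    intro x' h0 h1
    rw [blockEncoder_two, blockEncoder_two, Function.update_self,
      Function.update_of_ne (by decide)]
    simp only [h0, h1]
    by_cases h : encoder49 (fun q => x (0, q)) (l 0) = 0
    · rw [h, zero_mul, zero_mul]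
    · rw [← encoder49_add h]; rfl
  rw [mul_cnot_apply]
  refine (circuitOp_cnots_mul_apply _ (Finset.nodup_toList _) _ _ _).trans (key _ ?_ ?_)
  · exact fun q => if_neg fun h => absurd h.1 (by simp)
  · exact fun q => if_pos ⟨rfl, by simp⟩

/-! ### The Hadamard gate

On a block, the Hadamard gate of the corresponding Steane qubit is `(X' + Z') / √2` for the logical
operators `X'`, `Z'` of the block. -/

lemma update_add_eq {ι : Type} [DecidableEq ι] {i j : ι} (x : ι → ZMod 2) :
    Function.update x j (x j + x i) = x + Pi.single j (x i) := by
  ext p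
  by_cases hp : p = j
  · subst hp; simp
  · simp [hp]

section HadamardGadget
variable {ι : Type} [Fintype ι] [DecidableEq ι]

/-- `CNOT` copies a bit flip from the control to the target. -/
lemma cnot_mul_pauliX {i j : ι} (hij : i ≠ j) (a : ι → ZMod 2) :
    (Gate.cnot i j hij).op * pauliX a =
      pauliX (a + Pi.single j (a i)) * (Gate.cnot i j hij).op := by
  ext x y
  rw [cnot_mul_apply, pauliX_mul_apply]
  simp only [pauliX, Gate.op, Matrix.of_apply]
  refine boole_congr ?_
  rw [vec_eq_add_iff, update_add_involutive hij (x := x + _), update_add_eq, update_add_eq]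
  have h : x + (a + Pi.single j (a i)) +
      Pi.single j ((x + (a + Pi.single j (a i)) : ι → ZMod 2) i) = x + Pi.single j (x i) + a := by
    simp only [Pi.add_apply, Pi.single_eq_of_ne hij, add_zero, Pi.single_add]
    calc x + (a + Pi.single j (a i)) + (Pi.single j (x i) + Pi.single j (a i))
        = x + Pi.single j (x i) + a + (Pi.single j (a i) + Pi.single j (a i)) := by abel
      _ = _ := by rw [vec_add_self, add_zero]
  rw [h]

/-- `CNOT` copies a phase flip from the target to the control. -/
lemma cnot_mul_pauliZ {i j : ι} (hij : i ≠ j) (b : ι → ZMod 2) :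
    (Gate.cnot i j hij).op * pauliZ b =
      pauliZ (b + Pi.single i (b j)) * (Gate.cnot i j hij).op := by
  ext x y
  rw [mul_pauliZ_apply, pauliZ_mul_apply, mul_comm]
  simp only [Gate.op, Matrix.of_apply]
  split_ifs with h
  · congr 2
    rw [h, update_add_eq, add_dotProduct, dotProduct_add, dotProduct_add]
    simp only [dotProduct_single, single_dotProduct]
    rw [Pi.single_eq_of_ne hij.symm, zero_mul, add_zero, add_assoc, CharTwo.add_self_eq_zero,
      add_zero]
  · simp

variable {K : Type} {t : ι} {f : K → ι} (hf : ∀ k, t ≠ f k)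

lemma circuitOp_fanout_mul_pauliX (L : List K) (a : ι → ZMod 2) (ha : a t = 1) :
    circuitOp (L.map fun k => Gate.cnot t (f k) (hf k)) * pauliX a =
      pauliX (a + (L.map fun k => Pi.single (f k) 1).sum) *
        circuitOp (L.map fun k => Gate.cnot t (f k) (hf k)) := by
  induction L generalizing a with
  | nil => simp [circuitOp]
  | cons k L ih =>
    rw [List.map_cons, circuitOp, mul_assoc, cnot_mul_pauliX, ha, ← mul_assoc,
      ih _ (by simp [ha, hf k]), mul_assoc, List.map_cons, List.sum_cons, add_assoc]

lemma circuitOp_fanout_mul_pauliZ (L : List K) (b : ι → ZMod 2) (hb : ∀ k, b (f k) = 0) :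
    circuitOp (L.map fun k => Gate.cnot t (f k) (hf k)) * pauliZ b =
      pauliZ b * circuitOp (L.map fun k => Gate.cnot t (f k) (hf k)) := by
  induction L with
  | nil => simp [circuitOp]
  | cons k L ih =>
    rw [List.map_cons, circuitOp, mul_assoc, cnot_mul_pauliZ, hb, Pi.single_zero, add_zero,
      ← mul_assoc, ih, mul_assoc]

/-- A circuit of involutive gates is inverted by running it backwards. -/
lemma circuitOp_reverse_mul {C : List (Gate ι)} (hC : ∀ g ∈ C, g.op * g.op = 1) :
    circuitOp C.reverse * circuitOp C = 1 := by
  induction C with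
  | nil => simp [circuitOp]
  | cons g C ih =>
    rw [List.reverse_cons, circuitOp_append, circuitOp_singleton, circuitOp, mul_assoc,
      ← mul_assoc (circuitOp C.reverse), ih fun g' hg' => hC g' (by simp [hg']), one_mul,
      hC g (by simp)]

/-- The decoding part of the Hadamard circuit of a block: it maps the logical `X` of all the qubits
of the block to `X` on `t`, and the logical `Z` on `p`, `q`, `t` to `Z` on `t`. -/
def blockDecoder {p q : ι} (hp : p ≠ t) (hq : q ≠ t) (L : List K) : List (Gate ι) :=
  [.cnot p t hp, .cnot q t hq] ++ L.map fun k => .cnot t (f k) (hf k)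

lemma blockDecoder_mul_pauliX {p q : ι} (hp : p ≠ t) (hq : q ≠ t) (L : List K) {a : ι → ZMod 2}
    (hap : a p = 1) (haq : a q = 1) (hat : a t = 1)
    (ha : a + (L.map fun k => Pi.single (f k) 1).sum = Pi.single t 1) :
    circuitOp (blockDecoder hf hp hq L) * pauliX a =
      pauliX (Pi.single t 1) * circuitOp (blockDecoder hf hp hq L) := by
  have e : a + Pi.single t 1 + Pi.single t 1 = a := by
    rw [add_assoc, vec_add_self, add_zero]
  have hq' : (a + Pi.single t 1 : ι → ZMod 2) q = 1 := by simp [haq, hq]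
  rw [blockDecoder, circuitOp_append, circuitOp, circuitOp_singleton, mul_assoc, mul_assoc,
    cnot_mul_pauliX, hap, ← mul_assoc (Gate.op _) (pauliX _), cnot_mul_pauliX, hq', e, mul_assoc,
    ← mul_assoc, circuitOp_fanout_mul_pauliX hf L a hat, ha, mul_assoc]

lemma blockDecoder_mul_pauliZ {p q : ι} (hp : p ≠ t) (hq : q ≠ t) (L : List K) :
    circuitOp (blockDecoder hf hp hq L) *
        pauliZ (Pi.single p 1 + Pi.single q 1 + Pi.single t 1) =
      pauliZ (Pi.single t 1) * circuitOp (blockDecoder hf hp hq L) := by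
  have h1 : (Pi.single p 1 + Pi.single q 1 + Pi.single t 1 : ι → ZMod 2) t = 1 := by
    simp [hp.symm, hq.symm]
  have e1 : (Pi.single p 1 + Pi.single q 1 + Pi.single t 1 + Pi.single p 1 : ι → ZMod 2) =
      Pi.single t 1 + Pi.single q 1 := by
    rw [add_right_comm, add_right_comm (Pi.single p 1), vec_add_self, zero_add, add_comm]
  have h2 : (Pi.single t 1 + Pi.single q 1 : ι → ZMod 2) t = 1 := by simp [hq.symm]
  have e2 : (Pi.single t 1 + Pi.single q 1 + Pi.single q 1 : ι → ZMod 2) = Pi.single t 1 := by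
    rw [add_assoc, vec_add_self, add_zero]
  rw [blockDecoder, circuitOp_append, circuitOp, circuitOp_singleton, mul_assoc, mul_assoc,
    cnot_mul_pauliZ, h1, e1, ← mul_assoc (Gate.op _) (pauliZ _), cnot_mul_pauliZ, h2, e2, mul_assoc,
    ← mul_assoc, circuitOp_fanout_mul_pauliZ hf L _ (fun k => Pi.single_eq_of_ne (hf k).symm _),
    mul_assoc]

lemma blockDecoder_involutive {p q : ι} (hp : p ≠ t) (hq : q ≠ t) (L : List K) :
    ∀ g ∈ blockDecoder hf hp hq L, g.op * g.op = 1 := by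
  intro g hg
  simp only [blockDecoder, List.mem_append, List.mem_cons, List.not_mem_nil, or_false,
    List.mem_map] at hg
  rcases hg with (rfl | rfl) | ⟨k, -, rfl⟩ <;> exact cnot_mul_self _

/-- Decode the block, apply `H`, and encode again. -/
def blockHadamard {p q : ι} (hp : p ≠ t) (hq : q ≠ t) (L : List K) : List (Gate ι) :=
  blockDecoder hf hp hq L ++ [.h t] ++ (blockDecoder hf hp hq L).reverse

lemma circuitOp_blockHadamard {p q : ι} (hp : p ≠ t) (hq : q ≠ t) (L : List K)
    {a : ι → ZMod 2} (hap : a p = 1) (haq : a q = 1) (hat : a t = 1)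
    (ha : a + (L.map fun k => Pi.single (f k) 1).sum = Pi.single t 1) :
    circuitOp (blockHadamard hf hp hq L) = ((Real.sqrt 2 : ℝ) : ℂ)⁻¹ •
      (pauliX a + pauliZ (Pi.single p 1 + Pi.single q 1 + Pi.single t 1)) := by
  rw [blockHadamard, circuitOp_append, circuitOp_append, circuitOp_singleton, Gate.op_h,
    Matrix.smul_mul, Matrix.mul_smul, add_mul,
    ← blockDecoder_mul_pauliX hf hp hq L hap haq hat ha,
    ← blockDecoder_mul_pauliZ hf hp hq L, ← mul_add, ← mul_assoc,
    circuitOp_reverse_mul (blockDecoder_involutive hf hp hq L), one_mul]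

omit [Fintype ι] [DecidableEq ι] in
lemma blockDecoder_support {p q : ι} (hp : p ≠ t) (hq : q ≠ t) (L : List K) {S : Set ι}
    (hpS : p ∈ S) (hqS : q ∈ S) (htS : t ∈ S) (hfS : ∀ k, f k ∈ S) :
    ∀ g ∈ blockDecoder hf hp hq L, g.support ⊆ S := by
  intro g hg
  simp only [blockDecoder, List.mem_append, List.mem_cons, List.not_mem_nil, or_false,
    List.mem_map] at hg
  rcases hg with (rfl | rfl) | ⟨k, -, rfl⟩ <;> rintro r (rfl | rfl) <;>
    first | assumption | exact hfS k

omit [Fintype ι] [DecidableEq ι] in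
lemma blockHadamard_support {p q : ι} (hp : p ≠ t) (hq : q ≠ t) (L : List K) {S : Set ι}
    (hpS : p ∈ S) (hqS : q ∈ S) (htS : t ∈ S) (hfS : ∀ k, f k ∈ S) :
    ∀ g ∈ blockHadamard hf hp hq L, g.support ⊆ S := by
  intro g hg
  simp only [blockHadamard, List.mem_append, List.mem_singleton, List.mem_reverse] at hg
  rcases hg with (hg | rfl) | hg
  · exact blockDecoder_support hf hp hq L hpS hqS htS hfS g hg
  · rintro r rfl; exact htS
  · exact blockDecoder_support hf hp hq L hpS hqS htS hfS g hg

end HadamardGadget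

/-- The inner encoder on the register of a single code block. -/
def innerEncoder₁ : Matrix (Fin 1 × Qubit49 → ZMod 2) (Fin 7 → ZMod 2) ℂ :=
  innerEncoder.submatrix (fun x q => x (0, q)) id

/-- The Steane encoder on the register of a single logical qubit. -/
def steaneEncoder₁ : Matrix (Fin 7 → ZMod 2) (Fin 1 → ZMod 2) ℂ :=
  steaneEncoder.submatrix id fun l => l 0

lemma blockEncoder_one_eq : blockEncoder (Fin 1) = innerEncoder₁ * steaneEncoder₁ := by
  ext x l
  rw [blockEncoder, Matrix.of_apply, Fin.prod_univ_one, encoder49_eq_mul]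
  rfl

/-- The logical `X` of the block of the Steane qubit `b`. -/
def blockX (b : Fin 7) : Fin 1 × Qubit49 → ZMod 2 := fun r => if r.2.outer = b then 1 else 0

lemma blockX_mul_innerEncoder₁ (b : Fin 7) :
    pauliX (blockX b) * innerEncoder₁ = innerEncoder₁ * pauliX (Pi.single b 1) := by
  ext x y
  rw [pauliX_mul_apply, mul_pauliX_apply]
  simp only [innerEncoder₁, Matrix.submatrix_apply, innerEncoder, Matrix.of_apply, id]
  congr 1
  refine Finset.sum_congr rfl fun u _ => boole_congr ?_
  have h1 : (fun q => (x + blockX b) (0, q)) = (fun q => x (0, q)) + fun q => blockX b (0, q) := rfl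
  have h2 : (fun q : Qubit49 => (y + Pi.single b 1 : Fin 7 → ZMod 2) q.outer) =
      (fun q => y q.outer) + fun q => blockX b (0, q) := by
    ext q
    simp [blockX, Pi.single_apply]
  rw [h1, h2, eq_comm, vec_eq_add_iff, add_assoc]

/-- Basis states in the image of the inner encoder consist of Reed-Muller words on the blocks. -/
lemma exists_of_innerEncoder_ne_zero {x : Qubit49 → ZMod 2} {y : Fin 7 → ZMod 2}
    (h : innerEncoder x y ≠ 0) : ∃ u : {b : Fin 7 // b ∈ B₁} × Fin 4 → ZMod 2,
      x = (∑ p, u p • innerCheck p.1 (rmRow p.2)) + fun q => y q.outer := by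
  obtain ⟨u, _, hu⟩ := Finset.exists_ne_zero_of_sum_ne_zero (right_ne_zero_of_mul h)
  exact ⟨u, by by_contra h'; exact hu (if_neg h')⟩

lemma pauliZ_mul_innerEncoder₁ {z : Fin 1 × Qubit49 → ZMod 2} {b : Fin 7}
    (hz : ∀ x y, innerEncoder (fun q => x (0, q)) y ≠ 0 → z ⬝ᵥ x = y b) :
    pauliZ z * innerEncoder₁ = innerEncoder₁ * pauliZ (Pi.single b 1) := by
  ext x y
  rw [pauliZ_mul_apply, mul_pauliZ_apply, single_one_dotProduct, mul_comm]
  by_cases h : innerEncoder₁ x y = 0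
  · rw [h, zero_mul, zero_mul]
  · rw [hz x y h]

lemma rmRow_first_three : ∀ k : Fin 4, rmRow k 0 + rmRow k 1 + rmRow k 2 = 0 := by decide +kernel

/-- The Hadamard circuit on the block of the Steane qubit `b`. -/
def hStep (b : Fin 7) : List (Gate (Fin 1 × Qubit49)) :=
  if hb : b ∈ B₁ then
    blockHadamard (t := rmQubit 0 ⟨b, hb⟩ 2) (p := rmQubit 0 ⟨b, hb⟩ 0) (q := rmQubit 0 ⟨b, hb⟩ 1)
      (f := fun i : {i : Fin 15 // i ≠ 2} => rmQubit 0 ⟨b, hb⟩ i)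
      (fun i h => i.2 (by simpa [rmQubit] using h.symm)) (by simp [rmQubit]) (by simp [rmQubit])
      Finset.univ.toList
  else [.h (0, .inr ⟨b, hb⟩)]

lemma hStep_op_mul (b : Fin 7) :
    circuitOp (hStep b) * innerEncoder₁ = innerEncoder₁ * (Gate.h b).op := by
  suffices h : ∃ z : Fin 1 × Qubit49 → ZMod 2,
      (∀ x y, innerEncoder (fun q => x (0, q)) y ≠ 0 → z ⬝ᵥ x = y b) ∧
      circuitOp (hStep b) = ((Real.sqrt 2 : ℝ) : ℂ)⁻¹ • (pauliX (blockX b) + pauliZ z) by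
    obtain ⟨z, hz, h⟩ := h
    rw [h, Gate.op_h, Matrix.smul_mul, Matrix.mul_smul, Matrix.add_mul, Matrix.mul_add,
      blockX_mul_innerEncoder₁, pauliZ_mul_innerEncoder₁ hz]
  by_cases hb : b ∈ B₁
  · refine ⟨Pi.single (rmQubit 0 ⟨b, hb⟩ 0) 1 + Pi.single (rmQubit 0 ⟨b, hb⟩ 1) 1 +
      Pi.single (rmQubit 0 ⟨b, hb⟩ 2) 1, fun x y h => ?_, ?_⟩
    rotate_left
    · rw [hStep, dif_pos hb]
      refine circuitOp_blockHadamard _ _ _ _ (if_pos rfl) (if_pos rfl)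
        (if_pos rfl) ?_
      rw [Finset.sum_map_toList]
      ext ⟨a, q⟩
      obtain rfl : a = 0 := Subsingleton.elim _ _
      rw [Pi.add_apply, Finset.sum_apply]
      rcases q with ⟨c, j⟩ | c
      · by_cases hc : c = ⟨b, hb⟩
        · subst hc
          by_cases hj : j = 2
          · subst hj
            rw [Finset.sum_eq_zero fun i _ => ?_]
            · simp [blockX, Qubit49.outer]
            · rw [Pi.single_eq_of_ne]
              simpa [rmQubit] using fun h => i.2 h.symm
          · rw [Finset.sum_eq_single ⟨j, hj⟩]
            · simp [blockX, Qubit49.outer, hj, CharTwo.add_self_eq_zero]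
            · intro i _ hi
              rw [Pi.single_eq_of_ne]
              simpa [rmQubit] using fun h => hi (Subtype.ext h.symm)
            · simp
        · have hc' : c.1 ≠ b := fun h => hc (Subtype.ext h)
          simp [blockX, Qubit49.outer, hc, hc']
      · have hc' : c.1 ≠ b := fun h => c.2 (h ▸ hb)
        simp [blockX, Qubit49.outer, hc']
    · obtain ⟨u, hu⟩ := exists_of_innerEncoder_ne_zero h
      have hx : ∀ i, x (rmQubit 0 ⟨b, hb⟩ i) = ∑ k, u (⟨b, hb⟩, k) * rmRow k i + y b := fun i => by
        have := congrFun hu (.inl (⟨b, hb⟩, i))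
        rw [Pi.add_apply, sum_innerCheck_inl] at this
        exact this
      rw [add_dotProduct, add_dotProduct, single_one_dotProduct, single_one_dotProduct,
        single_one_dotProduct, hx, hx, hx]
      have h0 : ∑ k, u (⟨b, hb⟩, k) * rmRow k 0 + ∑ k, u (⟨b, hb⟩, k) * rmRow k 1 +
          ∑ k, u (⟨b, hb⟩, k) * rmRow k 2 = 0 := by
        rw [← Finset.sum_add_distrib, ← Finset.sum_add_distrib]
        exact Finset.sum_eq_zero fun k _ => by
          rw [← mul_add, ← mul_add, rmRow_first_three, mul_zero]
      linear_combination h0 + CharTwo.add_self_eq_zero (y b)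
  · refine ⟨Pi.single (0, .inr ⟨b, hb⟩) 1, fun x y h => ?_, ?_⟩
    · obtain ⟨u, hu⟩ := exists_of_innerEncoder_ne_zero h
      rw [single_one_dotProduct]
      have := congrFun hu (.inr ⟨b, hb⟩)
      rw [Pi.add_apply, sum_innerCheck_inr, zero_add] at this
      exact this
    · rw [hStep, dif_neg hb, circuitOp_singleton, Gate.op_h]
      congr 3
      ext ⟨a, q⟩
      obtain rfl : a = 0 := Subsingleton.elim _ _
      rcases q with ⟨c, j⟩ | c
      · have hc' : c.1 ≠ b := fun h => hb (h ▸ c.2)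
        simp [blockX, Qubit49.outer, hc']
      · by_cases hc : c.1 = b <;> simp [blockX, Qubit49.outer, Pi.single_apply, Subtype.ext_iff, hc]

/-- The circuit for `H`. -/
def hCircuit : List (Gate (Fin 1 × Qubit49)) := Finset.univ.toList.flatMap hStep

lemma hStep_support (b : Fin 7) : ∀ g ∈ hStep b, ∀ p ∈ g.support, p.2.outer = b := by
  intro g hg p hp
  rw [hStep] at hg
  split_ifs at hg with hb
  · exact blockHadamard_support _ _ _ _ (S := {r | r.2.outer = b}) rfl rfl rfl (fun i => rfl)
      g hg hp
  · rw [List.mem_singleton] at hg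
    subst hg
    rw [show p = _ from hp]
    rfl

lemma hCircuit_isSteaneTransversal : IsSteaneTransversal hCircuit := by
  intro g hg
  obtain ⟨b, -, hb⟩ := List.mem_flatMap.mp hg
  exact ⟨b, hStep_support b g hb⟩

lemma circuitOp_flatMap_hStep (L : List (Fin 7)) :
    circuitOp (L.flatMap hStep) * innerEncoder₁ = innerEncoder₁ * circuitOp (L.map Gate.h) := by
  induction L with
  | nil => simp [circuitOp]
  | cons b L ih =>
    rw [List.flatMap_cons, circuitOp_append, List.map_cons, circuitOp, Matrix.mul_assoc,
      hStep_op_mul, ← Matrix.mul_assoc, ih, Matrix.mul_assoc]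

/-- The Hadamard matrix of one qubit. -/
def hadamard : Matrix (ZMod 2) (ZMod 2) ℂ :=
  Matrix.of fun a b => ((Real.sqrt 2 : ℝ) : ℂ)⁻¹ * bitSign (a * b)

lemma op_h_eq_tensorFamily {ι : Type} [Fintype ι] [DecidableEq ι] (q : ι) :
    (Gate.h q).op = tensorFamily fun p => if p = q then hadamard else 1 := by
  ext x y
  simp only [Gate.op, Matrix.of_apply, tensorFamily]
  rw [← Finset.mul_prod_erase _ _ (Finset.mem_univ q), if_pos rfl]
  have h : ∏ p ∈ Finset.univ.erase q, (if p = q then hadamard else 1) (x p) (y p) =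
      if ∀ p, p ≠ q → x p = y p then 1 else 0 := by
    rw [Finset.prod_congr rfl (g := fun p => if x p = y p then (1 : ℂ) else 0) fun p hp => by
      rw [if_neg (Finset.ne_of_mem_erase hp), Matrix.one_apply], Finset.prod_boole]
    exact boole_congr (by simp)
  rw [h, hadamard, Matrix.of_apply, mul_ite, mul_one, mul_zero]

lemma circuitOp_map_h {ι : Type} [Fintype ι] [DecidableEq ι] (L : List ι) (hL : L.Nodup) :
    circuitOp (L.map Gate.h) = tensorFamily fun p => if p ∈ L then hadamard else 1 := by
  induction L with
  | nil =>
    ext x y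
    simp only [List.map_nil, circuitOp, tensorFamily, Matrix.of_apply, List.not_mem_nil, if_false,
      Matrix.one_apply, Finset.prod_boole]
    exact boole_congr (by simp [funext_iff])
  | cons q L ih =>
    rw [List.nodup_cons] at hL
    rw [List.map_cons, circuitOp, ih hL.2, op_h_eq_tensorFamily, tensorFamily_mul]
    congr 1
    ext1 p
    by_cases hp : p = q
    · subst hp; simp [hL.1]
    · simp [hp]

lemma circuitOp_all_h_apply (x y : Fin 7 → ZMod 2) :
    circuitOp ((Finset.univ : Finset (Fin 7)).toList.map Gate.h) x y =
      ((Real.sqrt 2 : ℝ) : ℂ)⁻¹ ^ 7 * bitSign (x ⬝ᵥ y) := by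
  rw [circuitOp_map_h _ (Finset.nodup_toList _)]
  simp [tensorFamily, hadamard, Finset.prod_mul_distrib, dotProduct, bitSign_sum]

/-- The Steane code is self-dual: a vector is a codeword, in exactly one way, if and only if its
syndrome vanishes, and then its parity is the encoded bit. -/
lemma card_steaneWord : ∀ (x : Fin 7 → ZMod 2) (m : ZMod 2),
    (∑ v : Fin 3 → ZMod 2, if x = (∑ k, v k • steaneRow k) + (fun _ => m) then 1 else 0) =
      if (fun k => steaneRow k ⬝ᵥ x) = 0 ∧ m = ∑ i, x i then 1 else 0 := by decide +kernel

lemma h_steaneEncoder₁ : circuitOp ((Finset.univ : Finset (Fin 7)).toList.map Gate.h) *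
    steaneEncoder₁ = steaneEncoder₁ * (Gate.h (0 : Fin 1)).op := by
  ext x l
  have hcard : ∀ m : ZMod 2, (∑ v : Fin 3 → ZMod 2,
      if x = (∑ k, v k • steaneRow k) + (fun _ => m) then (1 : ℂ) else 0) =
      if (fun k => steaneRow k ⬝ᵥ x) = 0 ∧ m = ∑ i, x i then 1 else 0 := fun m => by
    have := congrArg (Nat.cast (R := ℂ)) (card_steaneWord x m)
    push_cast at this
    exact this
  have hl : circuitOp ((Finset.univ : Finset (Fin 7)).toList.map Gate.h) * steaneEncoder₁ =
      Matrix.of fun x l => ((Real.sqrt 2 : ℝ) : ℂ)⁻¹ ^ 10 * (bitSign (l 0 * ∑ i, x i) *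
        if (fun k => steaneRow k ⬝ᵥ x) = 0 then 8 else 0) := by
    ext x l
    rw [Matrix.mul_apply, Matrix.of_apply]
    simp only [circuitOp_all_h_apply, steaneEncoder₁, Matrix.submatrix_apply, steaneEncoder,
      cssEncoder, Matrix.of_apply, id, Fintype.card_fin]
    have e : ∀ y : Fin 7 → ZMod 2, ((Real.sqrt 2 : ℝ) : ℂ)⁻¹ ^ 7 * bitSign (x ⬝ᵥ y) *
        (((Real.sqrt 2 : ℝ) : ℂ)⁻¹ ^ 3 * ∑ v : Fin 3 → ZMod 2,
          if y = (∑ k, v k • steaneRow k) + (fun _ => l 0) then 1 else 0) =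
        ((Real.sqrt 2 : ℝ) : ℂ)⁻¹ ^ 10 * ∑ v : Fin 3 → ZMod 2,
          if y = (∑ k, v k • steaneRow k) + (fun _ => l 0) then bitSign (x ⬝ᵥ y) else 0 := by
      intro y
      rw [mul_mul_mul_comm, ← pow_add, Finset.mul_sum]
      simp only [mul_ite, mul_one, mul_zero]
    rw [Finset.sum_congr rfl fun y _ => e y, ← Finset.mul_sum, Finset.sum_comm]
    congr 1
    have e2 : ∀ v : Fin 3 → ZMod 2, (∑ y : Fin 7 → ZMod 2,
        if y = (∑ k, v k • steaneRow k) + (fun _ => l 0) then bitSign (x ⬝ᵥ y) else 0) =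
        bitSign (l 0 * ∑ i, x i) * bitSign (v ⬝ᵥ fun k => steaneRow k ⬝ᵥ x) := by
      intro v
      rw [Finset.sum_ite_eq' Finset.univ, if_pos (Finset.mem_univ _), ← bitSign_add,
        dotProduct_add, add_comm, dotProduct_sum]
      congr 2
      · rw [Finset.mul_sum]
        exact Finset.sum_congr rfl fun i _ => mul_comm _ _
      · refine Finset.sum_congr rfl fun k _ => ?_
        rw [dotProduct_smul, dotProduct_comm x]
        rfl
    rw [Finset.sum_congr rfl fun v _ => e2 v, ← Finset.mul_sum, sum_bitSign_dotProduct]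
    norm_num
  rw [hl, Matrix.mul_apply, Matrix.of_apply,
    ← Equiv.sum_comp (Equiv.funUnique (Fin 1) (ZMod 2)).symm]
  have hr : ∀ m : ZMod 2, steaneEncoder₁ x ((Equiv.funUnique (Fin 1) (ZMod 2)).symm m) *
      (Gate.h (0 : Fin 1)).op ((Equiv.funUnique (Fin 1) (ZMod 2)).symm m) l =
      ((Real.sqrt 2 : ℝ) : ℂ)⁻¹ ^ 4 * (if m = ∑ i, x i then
        (if (fun k => steaneRow k ⬝ᵥ x) = 0 then bitSign (m * l 0) else 0) else 0) := by
    intro m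
    have h1 : steaneEncoder₁ x ((Equiv.funUnique (Fin 1) (ZMod 2)).symm m) =
        ((Real.sqrt 2 : ℝ) : ℂ)⁻¹ ^ 3 *
          if (fun k => steaneRow k ⬝ᵥ x) = 0 ∧ m = ∑ i, x i then 1 else 0 := by
      rw [← hcard]; rfl
    have h2 : (Gate.h (0 : Fin 1)).op ((Equiv.funUnique (Fin 1) (ZMod 2)).symm m) l =
        ((Real.sqrt 2 : ℝ) : ℂ)⁻¹ * bitSign (m * l 0) := by
      simp only [Gate.op, Matrix.of_apply]
      rw [if_pos fun p hp => absurd (Subsingleton.elim p 0) hp]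
      rfl
    rw [h1, h2]
    by_cases hm : m = ∑ i, x i <;> by_cases hs : (fun k => steaneRow k ⬝ᵥ x) = 0 <;>
      simp only [hm, hs, and_true, and_false, if_true, if_false] <;> ring
  rw [Finset.sum_congr rfl fun m _ => hr m, ← Finset.mul_sum, Finset.sum_ite_eq' Finset.univ,
    if_pos (Finset.mem_univ _)]
  have h8 : ((Real.sqrt 2 : ℝ) : ℂ)⁻¹ ^ 10 * 8 = ((Real.sqrt 2 : ℝ) : ℂ)⁻¹ ^ 4 := by
    rw [show 10 = 4 + 2 * 3 from rfl, pow_add, pow_mul, sq, sqrt_two_inv_sq]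
    ring
  split_ifs
  · rw [← h8, mul_comm (l 0)]; ring
  · ring

lemma hCircuit_op :
    circuitOp hCircuit * blockEncoder (Fin 1) = blockEncoder (Fin 1) * (Gate.h (0 : Fin 1)).op := by
  rw [blockEncoder_one_eq, ← Matrix.mul_assoc, hCircuit, circuitOp_flatMap_hStep, Matrix.mul_assoc,
    h_steaneEncoder₁, Matrix.mul_assoc]

end

theorem mainTheorem2 :
    Fintype.card Qubit49 = 49 ∧
    encoder49ᴴ * encoder49 = 1 ∧
    (∀ i, pauliX (xCheck i) * encoder49 = encoder49) ∧
    (∀ j, pauliZ (zCheck j) * encoder49 = encoder49) ∧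
    ∃ D : Decoder,
      (∑ s, ∑ t, (recovery D s t)ᴴ * recovery D s t = 1) ∧
      CorrectsSingleErrors D ∧
      (∃ C, IsTransversal C ∧ FaultTolerant D (Gate.s (0 : Fin 1)).op C) ∧
      (∃ C, IsTransversal C ∧ FaultTolerant D (Gate.cnot (0 : Fin 2) 1 (by decide)).op C) ∧
      (∃ C, IsSteaneTransversal C ∧ FaultTolerant D (Gate.h (0 : Fin 1)).op C) ∧
      (∃ C, IsRMTransversal C ∧ FaultTolerant D (Gate.t (0 : Fin 1)).op C) ∧
      (∃ C, IsRMTransversal C ∧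
        FaultTolerant D
          (Gate.ccz (0 : Fin 3) 1 2 (by decide) (by decide) (by decide)).op C) := by
  refine ⟨by decide +kernel, encoder49_isometry, fun i => ?_, fun j => ?_, decoder49,
    sum_recovery _, decoder49_corrects,
    ⟨_, sCircuit_isTransversal, sCircuit_isTransversal.faultTolerant sCircuit_op⟩,
    ⟨_, cnotCircuit_isTransversal, cnotCircuit_isTransversal.faultTolerant cnotCircuit_op⟩,
    ⟨_, hCircuit_isSteaneTransversal, hCircuit_isSteaneTransversal.faultTolerant hCircuit_op⟩,
    ⟨_, tCircuit_isRMTransversal, tCircuit_isRMTransversal.faultTolerant tCircuit_op⟩,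
    ⟨_, cczCircuit_isRMTransversal, cczCircuit_isRMTransversal.faultTolerant cczCircuit_op⟩⟩
  · simpa [Pi.single_apply, ite_smul] using pauliX_span_mul_encoder49 (Pi.single i 1)
  · simpa [Pi.single_apply, ite_smul] using pauliZ_span_mul_encoder49 (Pi.single j 1)
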